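/- Theorem (product version of the 1-2-3 Conjecture). Let $G$ be a finite simple graph that is nice, meaning that no connected component of $G$ is isomorphic to $K_2$. Then there is an edge-labelling $\ell : E(G) \to \{1,2,3\}$ such that, writing $\rho_\ell(v) = \prod_{u \in N(v)} \ell(uv)$ for the product of the labels of the edges incident to a vertex $v$ (an empty product being $1$), one has $\rho_\ell(u) \neq \rho_\ell(v)$ for every edge $uv \in E(G)$. Equivalently, $\chi_{\rm P}(G) \leq 3$, where $\chi_{\rm P}(G)$ is the smallest $k \geq 1$ such that there is a labelling $\ell : E(G) \to \{1,\dots,k\}$ with $\rho_\ell(u) \neq \rho_\ell(v)$ for every edge $uv \in E(G)$ (and $\chi_{\rm P}(G)=\infty$ if there is none). -/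

import Mathlib

/-- A `k`-labelling of a graph: an assignment of labels `1, …, k` to its edges. -/
abbrev SimpleGraph.EdgeLabelling123 {V : Type*} (G : SimpleGraph V) (k : ℕ) : Type _ :=
  G.edgeSet → Finset.Icc 1 k

/-- The product `∏_{u ∈ N(v)} ℓ(vu)` of the labels of the edges incident to `v`
(the empty product `1` if `v` is isolated). -/
def SimpleGraph.labelProduct {V : Type*} (G : SimpleGraph V) [G.LocallyFinite] {k : ℕ}
    (l : G.EdgeLabelling123 k) (v : V) : ℕ :=
  ∏ u : G.neighborSet v, (l ⟨s(v, (u : V)), (G.mem_edgeSet).mpr u.2⟩ : ℕ)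

/-- A labelling is p-proper if the products of incident labels form a proper vertex-colouring. -/
def SimpleGraph.IsPProper {V : Type*} (G : SimpleGraph V) [G.LocallyFinite] {k : ℕ}
    (l : G.EdgeLabelling123 k) : Prop :=
  ∀ u v : V, G.Adj u v → G.labelProduct l u ≠ G.labelProduct l v

/-- The smallest `k ≥ 1` such that a p-proper `k`-labelling exists; `⊤` if there is none. -/
noncomputable def SimpleGraph.chiP {V : Type*} (G : SimpleGraph V) [G.LocallyFinite] : ℕ∞ :=
  sInf {n : ℕ∞ | ∃ k : ℕ, n = k ∧ 1 ≤ k ∧ ∃ l : G.EdgeLabelling123 k, G.IsPProper l}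

/-- A graph is nice if none of its connected components is isomorphic to `K₂`. -/
def SimpleGraph.IsNice {V : Type*} (G : SimpleGraph V) : Prop :=
  ∀ c : G.ConnectedComponent, IsEmpty (c.toSimpleGraph ≃g completeGraph (Fin 2))

open Finset

/-! Write `d₂` and `d₃` for the numbers of edges labelled 2 and 3 at a vertex. The product there is
`2 ^ d₂ * 3 ^ d₃`, so adjacent vertices need distinct pairs `(d₂, d₃)`.

Take a proper colouring whose classes 1 and 2 induce a maximal bipartite subgraph `H` and in which a
vertex of colour `i ≥ 3` has neighbours of every smaller colour (`exists_layered_colouring`). From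
such a vertex, send non-1 labels to chosen neighbours of smaller colour: 2 towards even colours and
3 towards odd ones. All labels received from above are then of one kind, so the count of the other
kind can be made exactly `i / 2`. The remaining count is adjusted to be positive, with `d₂ + d₃` odd
for even `i` and even for odd `i` (`exists_out_sets`). Equal parities of colour are separated by the
exact count, different ones by the parity of `d₂ + d₃`.

The edges of `H` are labelled last (`exists_bipartite_labelling`). Each vertex of `H` ends with `d₂
= 0`, or `d₃ = 0`, or `d₃ = 1` and `d₂` even. No higher vertex has such a pair: both its counts are
positive, and `d₃ = 1` forces an odd colour and hence odd `d₂`. Within `H`, parity joins make `d₂`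
odd on one side and even on the other except at one root per component, which is repaired with a few
3s. The repair can only fail on a `K₂` component of `H` that receives nothing from above. The
colouring and the chosen edges ensure that every component of `H` with a neighbour outside receives
something, so the bad case would be a `K₂` component of `G`. -/

/-! ### Edge sets with prescribed degree parities. -/

theorem SimpleGraph.Reachable.exists_boundary {V : Type*} [Fintype V] {Γ : SimpleGraph V} {u v : V}
    (h : Γ.Reachable u v) :
    ∃ f : V → V → ZMod 2, (∀ x y, f x y = f y x) ∧ (∀ x y, f x y ≠ 0 → Γ.Adj x y ∧ Γ.Reachable u x) ∧
      ∀ x, x ≠ u → ∑ y, f x y = open Classical in if x = v then 1 else 0 := by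
  classical
  -- The edges of a walk, counted mod 2, have boundary `1_u + 1_v`. Induction along the walk moves
  -- `u`, so its term has to be kept.
  suffices H : ∃ f : V → V → ZMod 2, (∀ x y, f x y = f y x) ∧
      (∀ x y, f x y ≠ 0 → Γ.Adj x y ∧ Γ.Reachable u x) ∧
      ∀ x, ∑ y, f x y = (if x = u then 1 else 0) + if x = v then 1 else 0 by
    obtain ⟨f, h1, h2, h3⟩ := H
    refine ⟨f, h1, h2, fun x hx => ?_⟩
    rw [h3 x, if_neg hx, zero_add]
  obtain ⟨p⟩ := h
  induction p with
  | nil =>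
    refine ⟨fun _ _ => 0, fun _ _ => rfl, fun x y h => absurd rfl h, fun x => ?_⟩
    split_ifs <;> simp
    decide
  | @cons a b d hab p ih =>
    obtain ⟨f, h1, h2, h3⟩ := ih
    refine ⟨fun x y => f x y + ((if x = a ∧ y = b then 1 else 0) + if x = b ∧ y = a then 1 else 0),
      fun x y => ?_, fun x y h => ?_, fun x => ?_⟩
    · beta_reduce
      rw [h1 x y, add_comm (if x = a ∧ y = b then (1 : ZMod 2) else 0)]
      simp only [and_comm]
    · by_cases hf : f x y = 0
      · by_cases hx : x = a ∧ y = b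
        · obtain ⟨rfl, rfl⟩ := hx
          exact ⟨hab, .refl _⟩
        · by_cases hy : x = b ∧ y = a
          · obtain ⟨rfl, rfl⟩ := hy
            exact ⟨hab.symm, hab.reachable⟩
          · simp [hf, hx, hy] at h
      · exact ⟨(h2 x y hf).1, hab.reachable.trans (h2 x y hf).2⟩
    · rw [Finset.sum_add_distrib, h3 x, Finset.sum_add_distrib]
      have e1 : ∑ y, (if x = a ∧ y = b then (1 : ZMod 2) else 0) = if x = a then 1 else 0 := by
        by_cases hx : x = a <;> simp [hx]
      have e2 : ∑ y, (if x = b ∧ y = a then (1 : ZMod 2) else 0) = if x = b then 1 else 0 := by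
        by_cases hx : x = b <;> simp [hx]
      rw [e1, e2]
      generalize (if x = a then (1 : ZMod 2) else 0) = α
      generalize (if x = b then (1 : ZMod 2) else 0) = β
      generalize (if x = d then (1 : ZMod 2) else 0) = γ
      revert α β γ
      decide

/-- Rooted `T`-joins: prescribed degree parities in the component of `r`, except at `r` itself. -/
theorem SimpleGraph.exists_parity_join {V : Type*} [Fintype V] (Γ : SimpleGraph V) (r : V) (t : V → ℕ) :
    ∃ f : V → V → ℕ, (∀ x y, f x y = f y x) ∧ (∀ x y, f x y ≤ 1) ∧
      (∀ x y, f x y ≠ 0 → Γ.Adj x y ∧ Γ.Reachable r x) ∧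
      ∀ x, Γ.Reachable r x → x ≠ r → Even (∑ y, f x y + t x) := by
  classical
  have key : ∀ v : V, ∃ f : V → V → ZMod 2, (∀ x y, f x y = f y x) ∧
      (∀ x y, f x y ≠ 0 → Γ.Adj x y ∧ Γ.Reachable r x) ∧
      ∀ x, x ≠ r → ∑ y, f x y = if x = v ∧ Γ.Reachable r v then 1 else 0 := by
    intro v
    by_cases hv : Γ.Reachable r v
    · obtain ⟨f, h1, h2, h3⟩ := hv.exists_boundary
      refine ⟨f, h1, h2, fun x hx => ?_⟩
      simp [h3 x hx, hv]
    · exact ⟨fun _ _ => 0, fun _ _ => rfl, fun x y h => absurd rfl h, fun x _ => by simp [hv]⟩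
  choose f h1 h2 h3 using key
  -- Superpose mod 2 the paths from `r` to each `v`, taken `t v` times. Away from `r`, only the
  -- paths ending at `x` contribute to the parity at `x`.
  set g : V → V → ZMod 2 := fun x y => ∑ v, (t v : ZMod 2) * f v x y with hg
  refine ⟨fun x y => (g x y).val, fun x y => ?_, fun x y => ?_, fun x y h => ?_, fun x hx hxr => ?_⟩
  · simp only [hg, h1 _ x y]
  · have := ZMod.val_lt (g x y)
    beta_reduce
    omega
  · have h' : g x y ≠ 0 := fun h0 => h (by simp [h0])
    obtain ⟨v, -, hv⟩ := Finset.exists_ne_zero_of_sum_ne_zero h'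
    exact h2 v x y (right_ne_zero_of_mul hv)
  · rw [← ZMod.natCast_eq_zero_iff_even]
    push_cast
    simp only [ZMod.natCast_val, ZMod.cast_id', id]
    rw [hg, Finset.sum_comm]
    simp only [← Finset.mul_sum, h3 _ x hxr]
    have : ∀ v, (t v : ZMod 2) * (if x = v ∧ Γ.Reachable r v then 1 else 0) = if x = v then (t v : ZMod 2) else 0 := by
      intro v
      by_cases h : x = v
      · subst h; simp [hx]
      · simp [h]
    simp only [this, Finset.sum_ite_eq, Finset.mem_univ, if_true]
    exact CharTwo.add_self_eq_zero _

/-- The indicator function of the edge `ab`. -/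
def edgeIndicator {V : Type*} [DecidableEq V] (a b x y : V) : ℕ :=
  if (x = a ∧ y = b) ∨ (x = b ∧ y = a) then 1 else 0

theorem edgeIndicator_comm {V : Type*} [DecidableEq V] (a b x y : V) :
    edgeIndicator a b x y = edgeIndicator a b y x := by
  unfold edgeIndicator
  congr 1
  apply propext
  tauto

theorem edgeIndicator_ne_zero {V : Type*} [DecidableEq V] {a b x y : V} :
    edgeIndicator a b x y ≠ 0 ↔ (x = a ∧ y = b) ∨ (x = b ∧ y = a) := by
  unfold edgeIndicator
  split_ifs with h <;> simp [h]

theorem sum_edgeIndicator {V : Type*} [Fintype V] [DecidableEq V] {a b : V} (h : a ≠ b) (x : V) :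
    ∑ y, edgeIndicator a b x y = (if x = a then 1 else 0) + if x = b then 1 else 0 := by
  unfold edgeIndicator
  by_cases hx : x = a
  · subst hx
    simp [h]
  · by_cases hy : x = b
    · subst hy
      simp [hx]
    · simp [hx, hy]

/-! ### Components in which every edge has an end with count zero. -/

namespace SimpleGraph

variable {V : Type*} {Γ : SimpleGraph V}

theorem Reachable.exists_adj_of_ne {a b : V} (h : Γ.Reachable a b) (hab : a ≠ b) :
    ∃ o, Γ.Adj b o ∧ (Γ.deleteIncidenceSet b).Reachable a o := by
  obtain ⟨p⟩ := h
  induction p with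
  | nil => exact absurd rfl hab
  | @cons a a' b h p ih =>
    by_cases ha : a' = b
    · subst ha
      exact ⟨a, h.symm, .refl _⟩
    · obtain ⟨o, h1, h2⟩ := ih ha
      refine ⟨o, h1, Reachable.trans (Adj.reachable ?_) h2⟩
      exact Γ.deleteIncidenceSet_adj.2 ⟨h, hab, ha⟩

theorem Reachable.deleteIncidenceSet_of_not_reachable {v o u t : V}
    (h : (Γ.deleteIncidenceSet v).Reachable o u) (ht : ¬ (Γ.deleteIncidenceSet v).Reachable o t) :
    (Γ.deleteIncidenceSet t).Reachable o u := by
  obtain ⟨p⟩ := h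
  induction p with
  | nil => exact .refl _
  | @cons a a' b h p ih =>
    refine Reachable.trans (Adj.reachable ?_) (ih fun h' => ht (h.reachable.trans h'))
    refine Γ.deleteIncidenceSet_adj.2 ⟨(Γ.deleteIncidenceSet_adj.1 h).1, ?_, ?_⟩
    · rintro rfl
      exact ht (.refl _)
    · rintro rfl
      exact ht h.reachable

theorem Reachable.ne_of_deleteIncidenceSet {v o x : V}
    (h : (Γ.deleteIncidenceSet v).Reachable o x) (hov : o ≠ v) : x ≠ v := by
  obtain ⟨p⟩ := h
  induction p with
  | nil => exact hov
  | cons h p ih => exact ih (Γ.deleteIncidenceSet_adj.1 h).2.2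

/-- A zero vertex `v` and a neighbour `o` of it, such that all vertices of the component outside `v`
and the component of `o` in the graph without `v` are nonzero. -/
theorem exists_adj_forall_ne_zero [Fintype V] (c : V → ℕ)
    {u₀ v₀ : V}
    (hpair : ∀ x y, Γ.Reachable u₀ x → Γ.Adj x y → c x = 0 → c y = 0 → (∀ z, Γ.Adj x z → z = y) →
      (∀ z, Γ.Adj y z → z = x) → False)
    (h₀ : Γ.Adj u₀ v₀) (hu₀ : c u₀ = 0) :
    ∃ v o, Γ.Reachable u₀ v ∧ c v = 0 ∧ Γ.Adj v o ∧
      (∀ t, Γ.Reachable u₀ t → t ≠ v → ¬ (Γ.deleteIncidenceSet v).Reachable o t → c t ≠ 0) ∧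
      (c o = 0 → ∃ w, Γ.Adj o w ∧ w ≠ v) := by
  classical
  -- Choose the pair so that the component of `o` after deleting `v` is as large as possible. A zero
  -- vertex `t ≠ v` outside it would do better: deleting `t` leaves that component together with `v`
  -- in one piece.
  obtain ⟨⟨v, o⟩, hvo, hmax⟩ := Finset.exists_max_image
    (univ.filter fun p : V × V => Γ.Reachable u₀ p.1 ∧ c p.1 = 0 ∧ Γ.Adj p.1 p.2)
    (fun p => (univ.filter fun x => (Γ.deleteIncidenceSet p.1).Reachable p.2 x).card)
    ⟨(u₀, v₀), by simp [hu₀, h₀]⟩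
  simp only [mem_filter, mem_univ, true_and] at hvo hmax
  obtain ⟨hv, hcv, hadj⟩ := hvo
  refine ⟨v, o, hv, hcv, hadj, fun t ht htv hto hct => ?_, fun hco => ?_⟩
  · obtain ⟨o', ho', hr⟩ := (hv.symm.trans ht).exists_adj_of_ne htv.symm
    have h1 := hmax (t, o') ⟨ht, hct, ho'⟩
    refine absurd h1 (not_le.2 (Finset.card_lt_card ?_))
    have hot : o ≠ t := by
      rintro rfl
      exact hto (.refl _)
    have hvo' : (Γ.deleteIncidenceSet t).Adj v o :=
      Γ.deleteIncidenceSet_adj.2 ⟨hadj, htv.symm, hot⟩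
    refine Finset.ssubset_iff_subset_ne.2 ⟨fun u hu => ?_, fun he => ?_⟩
    · simp only [mem_filter, mem_univ, true_and] at hu ⊢
      exact (hr.symm.trans hvo'.reachable).trans (hu.deleteIncidenceSet_of_not_reachable hto)
    · have : v ∈ univ.filter fun x => (Γ.deleteIncidenceSet v).Reachable o x := by
        rw [he]
        simpa using hr.symm
      simp only [mem_filter, mem_univ, true_and] at this
      exact this.ne_of_deleteIncidenceSet hadj.ne' rfl
  · by_contra! hno
    refine hpair v o hv hadj hcv hco (fun z hz => ?_) hno
    -- Here `v` is the only neighbour of `o`, so the maximal component is `{o}`. A further neighbour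
    -- `z` of `v` makes the pair `(o, v)` better, since `v` and `z` stay together.
    by_contra hzo
    have h1 := hmax (o, v) ⟨hv.trans hadj.reachable, hco, hadj.symm⟩
    have h2 : (univ.filter fun x => (Γ.deleteIncidenceSet v).Reachable o x) ⊆ {o} := by
      intro x hx
      simp only [mem_filter, mem_univ, true_and] at hx
      rw [mem_singleton]
      obtain ⟨p⟩ := hx
      cases p with
      | nil => rfl
      | cons h p =>
        have := Γ.deleteIncidenceSet_adj.1 h
        exact absurd (hno _ this.1) this.2.2
    have h3 : ({v, z} : Finset V) ⊆ univ.filter fun x => (Γ.deleteIncidenceSet o).Reachable v x := by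
      intro x hx
      simp only [mem_insert, mem_singleton] at hx
      simp only [mem_filter, mem_univ, true_and]
      rcases hx with rfl | rfl
      · exact .refl _
      · exact Adj.reachable (Γ.deleteIncidenceSet_adj.2 ⟨hz, hadj.ne, hzo⟩)
    have h4 := Finset.card_le_card h2
    have h5 := Finset.card_le_card h3
    rw [Finset.card_pair hz.ne] at h5
    rw [Finset.card_singleton] at h4
    simp only at h1
    omega

/-- The component of `o` without `v` gets a join of 2s: even totals on the side of `v`, odd totals
on the side of `o`, with `o` itself uncontrolled. Since `v` has total 0, it fits the even side. The
other vertices of the big component are nonzero, so each of their edges goes to `v` and needs no new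
label. Only `o` may need 3s. -/
theorem exists_labelling_of_exists_zero_edge [Fintype V] (χ : V → Bool)
    (hχ : ∀ x y, Γ.Adj x y → χ x ≠ χ y) (c : V → ℕ) (hc : ∀ x y, Γ.Adj x y → c x = 0 ∨ c y = 0)
    {u₀ v₀ : V}
    (hpair : ∀ x y, Γ.Reachable u₀ x → Γ.Adj x y → c x = 0 → c y = 0 → (∀ z, Γ.Adj x z → z = y) →
      (∀ z, Γ.Adj y z → z = x) → False)
    (h₀ : Γ.Adj u₀ v₀) (hu₀ : c u₀ = 0) :
    ∃ f g : V → V → ℕ, (∀ x y, f x y = f y x) ∧ (∀ x y, g x y = g y x) ∧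
      (∀ x y, f x y + g x y ≤ 1) ∧
      (∀ x y, f x y + g x y ≠ 0 → Γ.Adj x y ∧ Γ.Reachable u₀ x) ∧
      (∀ x, Γ.Reachable u₀ x → ∑ y, g x y = 0 ∨ c x + ∑ y, f x y = 0 ∨
        (∑ y, g x y = 1 ∧ Even (c x + ∑ y, f x y))) ∧
      ∀ x y, Γ.Reachable u₀ x → Γ.Adj x y →
        c x + ∑ z, f x z ≠ c y + ∑ z, f y z ∨ ∑ z, g x z ≠ ∑ z, g y z := by
  classical
  obtain ⟨v, o, hv, hcv, hvo, hrest, hw⟩ := exists_adj_forall_ne_zero c hpair h₀ hu₀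
  set Δ := Γ.deleteIncidenceSet v with hΔ
  have hΔadj : ∀ {x y}, Δ.Adj x y ↔ Γ.Adj x y ∧ x ≠ v ∧ y ≠ v := Γ.deleteIncidenceSet_adj
  obtain ⟨f, fs, f1, fa, fp⟩ := Δ.exists_parity_join o (fun x => if χ x = χ v then c x else c x + 1)
  have f0 : ∀ x, ¬ Δ.Reachable o x → ∑ y, f x y = 0 := by
    intro x hx
    refine Finset.sum_eq_zero fun y _ => ?_
    by_contra h
    exact hx (fa x y h).2
  have hRv : ∀ {x}, Δ.Reachable o x → x ≠ v := fun h => h.ne_of_deleteIncidenceSet hvo.ne'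
  have fv : ∑ y, f v y = 0 := f0 v fun h => hRv h rfl
  have hov : χ o ≠ χ v := hχ _ _ hvo.symm
  have even_side : ∀ x, Δ.Reachable o x → χ x = χ v → Even (c x + ∑ y, f x y) := by
    intro x hx hxv
    have := fp x hx (by rintro rfl; exact hov hxv)
    rwa [if_pos hxv, add_comm] at this
  have odd_side : ∀ x, Δ.Reachable o x → χ x ≠ χ v → x ≠ o → Odd (c x + ∑ y, f x y) := by
    intro x hx hxv hxo
    have := fp x hx hxo
    rw [if_neg hxv] at this
    rw [← Nat.not_even_iff_odd]
    intro h
    rw [show ∑ y, f x y + (c x + 1) = (c x + ∑ y, f x y) + 1 by ring, Nat.even_add_one] at this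
    exact this h
  have hR : ∀ {x y}, Δ.Reachable o x → Γ.Adj x y → y ≠ v → Δ.Reachable o y := fun hx hxy hy =>
    hx.trans (Adj.reachable (hΔadj.2 ⟨hxy, hRv hx, hy⟩))
  have hor : Γ.Reachable u₀ o := hv.trans hvo.reachable
  have hRu : ∀ {x}, Δ.Reachable o x → Γ.Reachable u₀ x := fun h =>
    hor.trans (h.mono (Γ.deleteIncidenceSet_le v))
  have fΓ : ∀ x y, f x y ≠ 0 → Γ.Adj x y ∧ Γ.Reachable u₀ x := fun x y h =>
    ⟨(hΔadj.1 (fa x y h).1).1, hRu (fa x y h).2⟩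
  have fnv : ∀ y, f v y = 0 := fun y => by
    by_contra h
    exact hRv (fa v y h).2 rfl
  -- it suffices to choose the 3-labelled edges near `o`
  suffices H : ∃ g : V → V → ℕ, (∀ x y, g x y = g y x) ∧ (∀ x y, f x y + g x y ≤ 1) ∧
      (∀ x y, g x y ≠ 0 → Γ.Adj x y ∧ Γ.Reachable u₀ x) ∧
      (∀ x, x ≠ o → ∑ y, g x y ≤ 1) ∧
      (∀ x, x ≠ v → ¬ Δ.Reachable o x → ∑ y, g x y = 0) ∧
      (∀ x, x ≠ o → χ x ≠ χ v → ∑ y, g x y = 0) ∧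
      (∑ y, g o y = 0 ∨ c o + ∑ y, f o y = 0 ∨ (∑ y, g o y = 1 ∧ Even (c o + ∑ y, f o y))) ∧
      (∀ x, Γ.Adj o x →
        c o + ∑ z, f o z ≠ c x + ∑ z, f x z ∨ ∑ z, g o z ≠ ∑ z, g x z) by
    obtain ⟨g, gs, fg, ga, g1, g0, gχ, go, gox⟩ := H
    refine ⟨f, g, fs, gs, fg, fun x y h => ?_, fun x hx => ?_, ?_⟩
    · by_cases hf : f x y = 0
      · exact ga x y fun hg => h (by rw [hf, hg])
      · exact fΓ x y hf
    · by_cases hxo : x = o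
      · subst hxo; exact go
      by_cases hxv : x = v
      · subst hxv
        exact Or.inr (Or.inl (by rw [hcv, fv]))
      by_cases hxR : Δ.Reachable o x
      · by_cases hs : χ x = χ v
        · have := g1 x hxo
          have h2 := even_side x hxR hs
          rcases Nat.le_one_iff_eq_zero_or_eq_one.1 this with h | h
          · exact Or.inl h
          · exact Or.inr (Or.inr ⟨h, h2⟩)
        · exact Or.inl (gχ x hxo hs)
      · exact Or.inl (g0 x hxv hxR)
    · have main : ∀ x y, Γ.Reachable u₀ x → Γ.Adj x y → χ x = χ v →
        c x + ∑ z, f x z ≠ c y + ∑ z, f y z ∨ ∑ z, g x z ≠ ∑ z, g y z := by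
        intro x y hx hxy hxs
        have hys : χ y ≠ χ v := fun h => hχ _ _ hxy (hxs.trans h.symm)
        by_cases hyo : y = o
        · subst hyo
          rcases gox x hxy.symm with h | h
          · exact Or.inl h.symm
          · exact Or.inr h.symm
        have hyv : y ≠ v := by
          rintro rfl
          exact hys rfl
        by_cases hyR : Δ.Reachable o y
        · left
          have h1 := odd_side y hyR hys hyo
          have h2 : Even (c x + ∑ z, f x z) := by
            by_cases hxv : x = v
            · subst hxv
              simp [hcv, fv]
            · exact even_side x (hR hyR hxy.symm hxv) hxs
          intro h
          rw [h, ← Nat.not_odd_iff_even] at h2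
          exact h2 h1
        · left
          have hy0 := hrest y (hx.trans hxy.reachable) hyv hyR
          rw [f0 y hyR]
          have hx0 : c x = 0 := (hc x y hxy).resolve_right hy0
          have hxR : ¬ Δ.Reachable o x := fun h => hyR (hR h hxy hyv)
          rw [f0 x hxR]
          omega
      intro x y hx hxy
      by_cases hxs : χ x = χ v
      · exact main x y hx hxy hxs
      · have hys : χ y = χ v := by
          have := hχ _ _ hxy
          revert hxs this
          cases χ x <;> cases χ y <;> cases χ v <;> simp
        rcases main y x (hx.trans hxy.reachable) hxy.symm hys with h | h
        · exact Or.inl h.symm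
        · exact Or.inr h.symm
  have evx : ∀ x, Γ.Adj o x → Even (c x + ∑ z, f x z) := by
    intro x hx
    by_cases hxv : x = v
    · subst hxv
      simp [hcv, fv]
    · refine even_side x (hR (.refl _) hx hxv) ?_
      have h1 := hχ _ _ hx
      revert hov h1
      cases χ x <;> cases χ o <;> cases χ v <;> simp
  have indΓ : ∀ w, Γ.Adj o w → ∀ x y, edgeIndicator o w x y ≠ 0 → Γ.Adj x y ∧ Γ.Reachable u₀ x := by
    intro w hw x y h
    rcases edgeIndicator_ne_zero.1 h with ⟨rfl, rfl⟩ | ⟨rfl, rfl⟩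
    · exact ⟨hw, hor⟩
    · exact ⟨hw.symm, hor.trans hw.reachable⟩
  -- An odd total at `o` needs no 3s. An even nonzero total takes a 3 on `ov`: the total separates
  -- `o` from `v`, and `d₃` from its other neighbours. A zero total takes 3s on `ov` and `ow`,
  -- giving `d₃ = 2` at `o` against at most 1 at its neighbours.
  by_cases hodd : Odd (c o + ∑ z, f o z)
  · refine ⟨fun _ _ => 0, fun _ _ => rfl, fun x y => f1 x y, fun x y h => absurd rfl h, ?_, ?_, ?_, ?_, ?_⟩
    · simp
    · simp
    · simp
    · simp
    · intro x hx
      left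
      intro h
      rw [h, ← Nat.not_even_iff_odd] at hodd
      exact hodd (evx x hx)
  rw [Nat.not_odd_iff_even] at hodd
  by_cases he : c o + ∑ z, f o z = 0
  · have hfo : ∀ y, f o y = 0 := by
      have : ∑ z, f o z = 0 := by omega
      intro y
      exact Finset.sum_eq_zero_iff.1 this y (mem_univ _)
    obtain ⟨w, how, hwv⟩ := hw (by omega)
    have hsum : ∀ x, ∑ y, (edgeIndicator o v x y + edgeIndicator o w x y) =
        ((if x = o then 1 else 0) + if x = v then 1 else 0) + ((if x = o then 1 else 0) + if x = w then 1 else 0) := by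
      intro x
      rw [Finset.sum_add_distrib, sum_edgeIndicator hvo.ne', sum_edgeIndicator how.ne]
    have hwχ : χ w = χ v := by
      have h1 := hχ _ _ how
      revert hov h1
      cases χ w <;> cases χ o <;> cases χ v <;> simp
    refine ⟨fun x y => edgeIndicator o v x y + edgeIndicator o w x y, fun x y => ?_, fun x y => ?_,
      fun x y h => ?_, fun x hx => ?_, fun x hx hxR => ?_, fun x hx hxs => ?_, Or.inr (Or.inl he), fun x hx => ?_⟩
    · simp only [edgeIndicator_comm _ _ x y]
    · unfold edgeIndicator
      by_cases h1 : (x = o ∧ y = v) ∨ (x = v ∧ y = o)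
      · have hf : f x y = 0 := by
          rcases h1 with ⟨rfl, rfl⟩ | ⟨rfl, rfl⟩
          · exact hfo _
          · exact fnv _
        have h2 : ¬ ((x = o ∧ y = w) ∨ (x = w ∧ y = o)) := by
          rintro (⟨rfl, rfl⟩ | ⟨rfl, rfl⟩)
          · rcases h1 with ⟨-, h⟩ | ⟨h, -⟩
            · exact hwv h
            · exact hvo.ne h.symm
          · rcases h1 with ⟨h, h'⟩ | ⟨h, -⟩
            · exact how.ne h.symm
            · exact hwv h
        simp [h1, h2, hf]
      · by_cases h2 : (x = o ∧ y = w) ∨ (x = w ∧ y = o)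
        · have hf : f x y = 0 := by
            rcases h2 with ⟨rfl, rfl⟩ | ⟨rfl, rfl⟩
            · exact hfo _
            · rw [fs]; exact hfo _
          simp [h1, h2, hf]
        · simpa [h1, h2] using f1 x y
    · by_cases h1 : edgeIndicator o v x y = 0
      · exact indΓ w how x y fun h2 => h (by simp [h1, h2])
      · exact indΓ v hvo.symm x y h1
    · rw [hsum]
      by_cases hxv : x = v
      · subst hxv
        simp [hx, hwv.symm]
      · simp only [hx, hxv, if_false]
        split_ifs <;> simp
    · rw [hsum]
      have h1 : x ≠ o := by
        rintro rfl; exact hxR (.refl _)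
      have h2 : x ≠ w := by
        rintro rfl; exact hxR (hR (.refl _) how hwv)
      simp [hx, h1, h2]
    · rw [hsum]
      have h1 : x ≠ v := by
        rintro rfl; exact hxs rfl
      have h2 : x ≠ w := by
        rintro rfl; exact hxs hwχ
      simp [hx, h1, h2]
    · right
      rw [hsum, hsum]
      have hxo : x ≠ o := hx.ne'
      by_cases hxv : x = v
      · subst hxv
        simp [hxo, hxo.symm, hwv.symm, how.ne]
      · by_cases hxw : x = w
        · subst hxw
          simp [hxo, hxv, hvo.ne', hxo.symm]
        · simp [hxo, hxv, hxw, hvo.ne', how.ne]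
  · have hsum : ∀ x, ∑ y, edgeIndicator o v x y =
        ((if x = o then 1 else 0) + if x = v then 1 else 0) := fun x => sum_edgeIndicator hvo.ne' x
    refine ⟨edgeIndicator o v, fun x y => edgeIndicator_comm _ _ x y, fun x y => ?_,
      indΓ v hvo.symm, fun x hx => ?_, fun x hx hxR => ?_, fun x hx hxs => ?_, Or.inr (Or.inr ⟨?_, hodd⟩),
      fun x hx => ?_⟩
    · unfold edgeIndicator
      by_cases h1 : (x = o ∧ y = v) ∨ (x = v ∧ y = o)
      · have hf : f x y = 0 := by
          rcases h1 with ⟨rfl, rfl⟩ | ⟨rfl, rfl⟩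
          · rw [fs]; exact fnv _
          · exact fnv _
        simp [h1, hf]
      · simpa [h1] using f1 x y
    · rw [hsum]
      simp only [hx, if_false]
      split_ifs <;> simp
    · rw [hsum]
      have h1 : x ≠ o := by
        rintro rfl; exact hxR (.refl _)
      simp [hx, h1]
    · rw [hsum]
      have h1 : x ≠ v := by
        rintro rfl; exact hxs rfl
      simp [hx, h1]
    · rw [hsum]
      simp [hvo.ne']
    · by_cases hxv : x = v
      · subst hxv
        left
        rw [hcv, fv]
        exact he
      · right
        rw [hsum, hsum]
        simp [hxv, hx.ne', hvo.ne']


/-! ### Covering edge sets with uniform parity on one side. -/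

theorem Reachable.exists_adj_dist_lt {V : Type*} {Q : SimpleGraph V} {r x : V} (h : Q.Reachable r x)
    (hne : x ≠ r) : ∃ p, Q.Adj x p ∧ Q.dist r p < Q.dist r x := by
  obtain ⟨p, hp⟩ := h.symm.exists_walk_length_eq_dist
  cases p with
  | nil => exact absurd rfl hne
  | @cons _ y _ h p =>
    refine ⟨y, h, ?_⟩
    rw [Q.dist_comm (u := r), Q.dist_comm (u := r), ← hp, Walk.length_cons]
    exact Nat.lt_succ_of_le (dist_le p)

/-- In a bipartite graph with parts `P` and `W`, some edge set covers `P` while all vertices of `W` in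
the same component have degrees of the same parity, up to the given correction `c`. -/
theorem exists_covering_of_parity {V : Type*} [Fintype V] (Q : SimpleGraph V) (P W : V → Prop)
    (hPW : ∀ x, P x → ¬ W x) (hQ : ∀ x y, Q.Adj x y → (P x ∧ W y) ∨ (W x ∧ P y)) (c : V → ℕ)
    (hP : ∀ b, P b → ∃ w, Q.Adj b w) :
    ∃ (S : V → V → ℕ) (π : V → ℕ), (∀ x y, S x y = S y x) ∧ (∀ x y, S x y ≤ 1) ∧
      (∀ x y, S x y ≠ 0 → Q.Adj x y) ∧ (∀ x y, Q.Adj x y → π x = π y) ∧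
      (∀ b, P b → ∑ y, S b y ≠ 0) ∧ ∀ w, W w → Even (c w + ∑ y, S w y + π w) := by
  classical
  have hroot : ∀ C : Q.ConnectedComponent, ∃ r : V,
      (∃ w, W w ∧ Q.connectedComponentMk w = C) → W r ∧ Q.connectedComponentMk r = C := by
    intro C
    by_cases h : ∃ w, W w ∧ Q.connectedComponentMk w = C
    · exact ⟨h.choose, fun _ => h.choose_spec⟩
    · obtain ⟨x, -⟩ := C.exists_rep
      exact ⟨x, fun h' => absurd h' h⟩
  choose root hroot using hroot
  set ρ : V → V := fun x => root (Q.connectedComponentMk x) with hρ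
  have hρW : ∀ w, W w → W (ρ w) ∧ Q.Reachable (ρ w) w := fun w hw =>
    ⟨(hroot _ ⟨w, hw, rfl⟩).1, ConnectedComponent.exact (hroot _ ⟨w, hw, rfl⟩).2⟩
  have hρadj : ∀ x y, Q.Adj x y → ρ x = ρ y := fun x y h => by
    simp only [hρ]
    rw [ConnectedComponent.sound h.reachable]
  have hpar : ∀ x, ∃ p, Q.Reachable (ρ x) x → x ≠ ρ x →
      Q.Adj x p ∧ Q.dist (ρ x) p < Q.dist (ρ x) x := by
    intro x
    by_cases h : Q.Reachable (ρ x) x ∧ x ≠ ρ x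
    · obtain ⟨p, hp⟩ := h.1.exists_adj_dist_lt h.2
      exact ⟨p, fun _ _ => hp⟩
    · exact ⟨x, fun h1 h2 => absurd ⟨h1, h2⟩ h⟩
  choose p hp using hpar
  set deg : V → ℕ := fun x => ∑ y, if Q.Adj x y then 1 else 0 with hdeg
  set π : V → ℕ := fun x => c (ρ x) + deg (ρ x) with hπ
  have hπadj : ∀ x y, Q.Adj x y → π x = π y := fun x y h => by simp only [hπ, hρadj x y h]
  -- Start from all edges of `Q`. Each `w` in `W` of wrong parity deletes the edge to its parent,
  -- one step nearer the root. The root lies in `W` and defines `π`, so it never deletes.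
  set M : V → V → Prop := fun x y => W x ∧ y = p x ∧ Odd (c x + deg x + π x) with hM
  have hodd_ne : ∀ x, W x → Odd (c x + deg x + π x) → x ≠ ρ x := by
    intro x _ h hx
    simp only [hπ, ← hx] at h
    rw [← Nat.not_even_iff_odd] at h
    exact h ⟨_, rfl⟩
  refine ⟨fun x y => if Q.Adj x y ∧ ¬ M x y ∧ ¬ M y x then 1 else 0, π, fun x y => ?_, fun x y => ?_,
    fun x y h => ?_, hπadj, fun b hb => ?_, fun w hw => ?_⟩
  · simp only [Q.adj_comm x y, and_comm (a := ¬ M x y)]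
  · beta_reduce
    split_ifs <;> simp
  · by_contra h'
    simp [h'] at h
  · obtain ⟨w, hw⟩ := hP b hb
    have hWw : W w := ((hQ _ _ hw).resolve_right fun h => hPW b hb h.1).2
    have hρb : ρ b = ρ w := hρadj _ _ hw
    have hbr : Q.Reachable (ρ b) b := hρb ▸ (hρW w hWw).2.trans hw.symm.reachable
    have hbne : b ≠ ρ b := fun h => hPW b hb (h ▸ hρb ▸ (hρW w hWw).1)
    obtain ⟨h1, h2⟩ := hp b hbr hbne
    have h3 : ¬ M b (p b) := fun h => hPW b hb h.1
    -- The edge from `b` to its own parent survives: its other end could delete it only if `b` were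
    -- nearer the root.
    have h4 : ¬ M (p b) b := by
      rintro ⟨h5, h6, h7⟩
      have h8 := hp (p b) (hρW _ h5).2 (hodd_ne _ h5 h7)
      rw [← h6, ← hρadj _ _ h1] at h8
      exact absurd h8.2 (not_lt.2 h2.le)
    intro h
    have := Finset.sum_eq_zero_iff.1 h (p b) (mem_univ _)
    simp [h1, h3, h4] at this
  · have key : ∑ y, (if Q.Adj w y ∧ ¬ M w y ∧ ¬ M y w then 1 else 0) +
        (if Odd (c w + deg w + π w) then 1 else 0) = deg w := by
      have h1 : ∀ y, (if Q.Adj w y ∧ ¬ M w y ∧ ¬ M y w then 1 else 0) +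
          (if Odd (c w + deg w + π w) ∧ y = p w then 1 else 0) = if Q.Adj w y then 1 else 0 := by
        intro y
        by_cases hy : Q.Adj w y
        · have hyP : ¬ M y w := fun h => by
            rcases hQ _ _ hy with h' | h'
            · exact hPW _ h'.1 hw
            · exact hPW _ h'.2 h.1
          by_cases hm : M w y
          · simp [hy, hm, hm.2.2, hm.2.1.symm]
          · have : ¬ (Odd (c w + deg w + π w) ∧ y = p w) := fun h => hm ⟨hw, h.2, h.1⟩
            simp [hy, hm, hyP, this]
        · have : ¬ (Odd (c w + deg w + π w) ∧ y = p w) := by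
            rintro ⟨h, rfl⟩
            exact hy (hp w (hρW w hw).2 (hodd_ne w hw h)).1
          simp [hy, this]
      have h2 : (if Odd (c w + deg w + π w) then 1 else 0) =
          ∑ y, if Odd (c w + deg w + π w) ∧ y = p w then 1 else 0 := by
        by_cases h : Odd (c w + deg w + π w) <;> simp [h]
      rw [h2, ← Finset.sum_add_distrib]
      exact Finset.sum_congr rfl fun y _ => h1 y
    split_ifs at key with h
    · have h3 : c w + deg w + π w =
          (c w + ∑ y, (if Q.Adj w y ∧ ¬ M w y ∧ ¬ M y w then 1 else 0) + π w) + 1 := by omega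
      rw [h3, Nat.odd_add_one, Nat.not_odd_iff_even] at h
      exact h
    · rw [add_zero] at key
      rw [key]
      exact Nat.not_odd_iff_even.1 h


/-! ### Labelling the bipartite part. -/

/-- Labels of a bipartite graph by `1`, `2` (indicated by `f`) and `3` (indicated by `g`), when vertices
of one side already carry `2`s and those of the other side already carry `3`s. -/
theorem exists_bipartite_labelling {V : Type*} [Fintype V] (H : SimpleGraph V) (χ : V → Bool)
    (hχ : ∀ x y, H.Adj x y → χ x ≠ χ y) (c : V → ℕ)
    (hpair : ∀ x y, H.Adj x y → c x = 0 → c y = 0 → (∀ z, H.Adj x z → z = y) →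
      (∀ z, H.Adj y z → z = x) → False) :
    ∃ f g : V → V → ℕ, (∀ x y, f x y = f y x) ∧ (∀ x y, g x y = g y x) ∧
      (∀ x y, f x y + g x y ≤ 1) ∧ (∀ x y, f x y + g x y ≠ 0 → H.Adj x y) ∧
      ∃ d₂ d₃ : V → ℕ, (∀ x, d₂ x = (if χ x then c x else 0) + ∑ y, f x y) ∧
        (∀ x, d₃ x = (if χ x then 0 else c x) + ∑ y, g x y) ∧
        (∀ x, d₂ x = 0 ∨ d₃ x = 0 ∨ (d₃ x = 1 ∧ Even (d₂ x))) ∧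
        ∀ x y, H.Adj x y → d₂ x ≠ d₂ y ∨ d₃ x ≠ d₃ y := by
  classical
  -- Vertices of `W` already carry 3s and get no 2s, so they end with `d₂ = 0` and `d₃ ≠ 0`. Without
  -- them, every vertex with `χ` false has count zero.
  set W : V → Prop := fun x => χ x = false ∧ c x ≠ 0 with hW
  set Γ : SimpleGraph V :=
    { Adj := fun x y => H.Adj x y ∧ ¬ W x ∧ ¬ W y
      symm := ⟨fun x y h => ⟨h.1.symm, h.2.2, h.2.1⟩⟩
      loopless := ⟨fun x h => H.loopless.irrefl x h.1⟩ } with hΓ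
  have hΓadj : ∀ {x y}, Γ.Adj x y ↔ H.Adj x y ∧ ¬ W x ∧ ¬ W y := Iff.rfl
  have hcW : ∀ {x}, ¬ W x → χ x = false → c x = 0 := fun hx h => by
    by_contra h'; exact hx ⟨h, h'⟩
  have hWt : ∀ {x}, χ x = true → ¬ W x := fun h h' => by simp [h'.1] at h
  set κ : V → Γ.ConnectedComponent := fun x => Γ.connectedComponentMk x with hκ
  have hκadj : ∀ {x y}, Γ.Adj x y → κ x = κ y := fun h => ConnectedComponent.sound h.reachable
  -- A marked component has a nontrivial vertex with a neighbour in `W`; taken as root, it can be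
  -- repaired by 3s towards `W`. An unmarked component with an edge has no neighbour in `W` at all.
  set mk : V → Prop := fun b => χ b = true ∧ (∃ w, W w ∧ H.Adj b w) ∧ ∃ a, Γ.Adj b a with hmk
  set marked : Γ.ConnectedComponent → Prop := fun C => ∃ b, κ b = C ∧ mk b with hmarked
  have hc0 : ∀ x y, Γ.Adj x y → c x = 0 ∨ c y = 0 := by
    intro x y h
    have h1 := hχ x y h.1
    by_cases hx : χ x = false
    · exact Or.inl (hcW h.2.1 hx)
    · refine Or.inr (hcW h.2.2 ?_)
      revert h1 hx
      cases χ x <;> cases χ y <;> simp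
  have comp : ∀ C : Γ.ConnectedComponent, ∃ (f g : V → V → ℕ) (β : V),
      (∀ x y, f x y = f y x) ∧ (∀ x y, g x y = g y x) ∧ (∀ x y, f x y + g x y ≤ 1) ∧
      (∀ x y, f x y + g x y ≠ 0 → Γ.Adj x y ∧ κ x = C) ∧
      (marked C → κ β = C ∧ mk β ∧ (∀ x y, g x y = 0) ∧
        ∀ x, κ x = C → x ≠ β → Even (∑ y, f x y + if χ x then c x + 1 else 0)) ∧
      (¬ marked C → (∀ x, κ x = C → ∑ y, g x y = 0 ∨ c x + ∑ y, f x y = 0 ∨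
          (∑ y, g x y = 1 ∧ Even (c x + ∑ y, f x y))) ∧
        ∀ x y, κ x = C → Γ.Adj x y →
          c x + ∑ z, f x z ≠ c y + ∑ z, f y z ∨ ∑ z, g x z ≠ ∑ z, g y z) := by
    intro C
    by_cases hC : marked C
    · obtain ⟨b, hb, hbm⟩ := hC
      -- Totals become odd where `χ` is true and even where it is false, except at the root `b`.
      obtain ⟨f, fs, f1, fa, fp⟩ := Γ.exists_parity_join b (fun x => if χ x then c x + 1 else 0)
      refine ⟨f, fun _ _ => 0, b, fs, fun _ _ => rfl, fun x y => f1 x y, fun x y h => ?_, fun _ => ?_,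
        fun h => absurd ⟨b, hb, hbm⟩ h⟩
      · obtain ⟨h1, h2⟩ := fa x y h
        exact ⟨h1, hb ▸ (ConnectedComponent.sound h2).symm⟩
      · refine ⟨hb, hbm, fun _ _ => rfl, fun x hx hxb => fp x ?_ hxb⟩
        exact (ConnectedComponent.exact (hx.trans hb.symm)).symm
    · have hall : ∀ x y, κ x = C → Γ.Adj x y → ∀ z, H.Adj x z → Γ.Adj x z := by
        intro x y hx hxy z hxz
        refine ⟨hxz, hxy.2.1, fun hz => hC ⟨x, hx, ?_, ⟨z, hz, hxz⟩, y, hxy⟩⟩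
        have := hχ _ _ hxz
        rw [hz.1] at this
        simpa using this
      by_cases hz : ∃ u v, κ u = C ∧ Γ.Adj u v ∧ c u = 0 ∧ c v = 0
      · obtain ⟨u, v, hu, huv, hcu, hcv⟩ := hz
        have hreach : ∀ {x}, Γ.Reachable u x ↔ κ x = C := fun {x} =>
          ⟨fun h => hu ▸ (ConnectedComponent.sound h).symm,
            fun h => ConnectedComponent.exact (hu.trans h.symm)⟩
        obtain ⟨f, g, h1, h2, h3, h4, h5, h6⟩ := exists_labelling_of_exists_zero_edge (Γ := Γ) χ
          (fun x y h => hχ x y h.1) c hc0 (u₀ := u) (v₀ := v)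
          (fun x y hx hxy hcx hcy hnx hny => by
            rw [hreach] at hx
            have hy : κ y = C := (hκadj hxy).symm.trans hx
            exact hpair x y hxy.1 hcx hcy (fun z hz => hnx z (hall x y hx hxy z hz))
              (fun z hz => hny z (hall y x hy hxy.symm z hz)))
          huv hcu
        refine ⟨f, g, u, h1, h2, h3, fun x y h => ?_, fun h => absurd h hC, fun _ => ⟨fun x hx => ?_,
          fun x y hx => ?_⟩⟩
        · exact ⟨(h4 x y h).1, hreach.1 (h4 x y h).2⟩
        · exact h5 x (hreach.2 hx)
        · exact h6 x y (hreach.2 hx)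
      -- Every edge now has exactly one end with count zero, so label 1 throughout suffices.
      · obtain ⟨x₀, -⟩ := C.exists_rep
        refine ⟨fun _ _ => 0, fun _ _ => 0, x₀, fun _ _ => rfl, fun _ _ => rfl, fun _ _ => by simp,
          fun x y h => absurd rfl h, fun h => absurd h hC, fun _ => ⟨fun x _ => by simp, ?_⟩⟩
        intro x y hx hxy
        left
        have := hc0 x y hxy
        intro h
        simp only [Finset.sum_const_zero, add_zero] at h
        exact hz ⟨x, y, hx, hxy, by omega, by omega⟩
  choose F G β Fs Gs FG1 FGa hM hU using comp
  set f : V → V → ℕ := fun x y => F (κ x) x y with hf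
  set g₀ : V → V → ℕ := fun x y => G (κ x) x y with hg₀
  have fg1 : ∀ x y, f x y + g₀ x y ≤ 1 := fun x y => FG1 _ x y
  have fga : ∀ x y, f x y + g₀ x y ≠ 0 → Γ.Adj x y := fun x y h => (FGa _ x y h).1
  have hFs : ∀ x y, f x y = f y x ∧ g₀ x y = g₀ y x := by
    intro x y
    by_cases h : κ x = κ y
    · simp only [hf, hg₀, h, Fs _ x y, Gs _ x y, and_self]
    · have h1 : f x y + g₀ x y = 0 := by
        by_contra h'
        exact h (hκadj (fga x y h'))
      have h2 : f y x + g₀ y x = 0 := by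
        by_contra h'
        exact h (hκadj (fga y x h')).symm
      omega
  set D : V → ℕ := fun x => c x + ∑ y, f x y with hD
  set isβ : V → Prop := fun b => marked (κ b) ∧ b = β (κ b) with hisβ
  have hβ : ∀ {b}, isβ b → mk b := fun {b} hb => by
    have := (hM (κ b) hb.1).2.1
    rwa [← hb.2] at this
  have hsel : ∀ b, ∃ w a, isβ b → (W w ∧ H.Adj b w) ∧ Γ.Adj b a := by
    intro b
    by_cases hb : isβ b
    · obtain ⟨-, ⟨w, hw⟩, a, ha⟩ := hβ hb
      exact ⟨w, a, fun _ => ⟨hw, ha⟩⟩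
    · exact ⟨b, b, fun h => absurd h hb⟩
  choose ω α hωα using hsel
  -- A root with odd `D` is already fine. With `D` even and nonzero, one 3 towards `W` separates it
  -- from its `Γ`-neighbours by `d₃`, and from `W` by `d₂ ≠ 0`. With `D = 0` it ties with `W` in
  -- `d₂`, so its `d₃` must be nonzero and of parity opposite to that of its neighbours in `W`.
  set Src : V → Prop := fun b => isβ b ∧ D b ≠ 0 ∧ Even (D b) with hSrc
  set Pend : V → Prop := fun b => isβ b ∧ D b = 0 with hPend
  have hSrcχ : ∀ {b}, Src b → χ b = true := fun h => (hβ h.1).1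
  have hPendχ : ∀ {b}, Pend b → χ b = true := fun h => (hβ h.1).1
  set s : V → V → ℕ := fun x y => if (Src x ∧ y = ω x) ∨ (Src y ∧ x = ω y) then 1 else 0 with hs
  set Q : SimpleGraph V :=
    { Adj := fun x y => H.Adj x y ∧ ((Pend x ∧ W y) ∨ (W x ∧ Pend y))
      symm := ⟨fun x y h => ⟨h.1.symm, h.2.symm.imp And.symm And.symm⟩⟩
      loopless := ⟨fun x h => H.loopless.irrefl x h.1⟩ } with hQ
  obtain ⟨S, π, Ss, S1, Sa, Sπ, SP, SW⟩ := Q.exists_covering_of_parity Pend W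
    (fun x hx => hWt (hPendχ hx)) (fun x y h => h.2) (fun x => c x + ∑ y, s x y) (fun b hb => by
      have := (hωα b hb.1).1
      exact ⟨ω b, this.2, Or.inl ⟨hb, this.1⟩⟩)
  -- If the covering set gives a pending root the same `d₃` parity as its neighbours in `W`, one
  -- more 3 goes to a `Γ`-neighbour `α`. The root then has `d₃ ≥ 2`, while `α` has `d₃ = 1` and even
  -- `d₂`.
  set jj : V → Prop := fun b => Pend b ∧ Even (∑ y, S b y + π b) with hjj
  set J : V → V → ℕ := fun x y => if (jj x ∧ y = α x) ∨ (jj y ∧ x = α y) then 1 else 0 with hJ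
  have sW : ∀ x y, s x y ≠ 0 → H.Adj x y ∧ ((Src x ∧ W y) ∨ (W x ∧ Src y)) := by
    intro x y h
    by_cases h' : (Src x ∧ y = ω x) ∨ (Src y ∧ x = ω y)
    · rcases h' with ⟨h1, rfl⟩ | ⟨h1, rfl⟩
      · have := (hωα x h1.1).1
        exact ⟨this.2, Or.inl ⟨h1, this.1⟩⟩
      · have := (hωα y h1.1).1
        exact ⟨this.2.symm, Or.inr ⟨this.1, h1⟩⟩
    · simp [hs, h'] at h
  have JΓ : ∀ x y, J x y ≠ 0 → Γ.Adj x y ∧ (jj x ∨ jj y) := by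
    intro x y h
    by_cases h' : (jj x ∧ y = α x) ∨ (jj y ∧ x = α y)
    · rcases h' with ⟨h1, rfl⟩ | ⟨h1, rfl⟩
      · exact ⟨(hωα x h1.1.1).2, Or.inl h1⟩
      · exact ⟨(hωα y h1.1.1).2.symm, Or.inr h1⟩
    · simp [hJ, h'] at h
  have zero_of_pend : ∀ {b}, Pend b → ∀ y, f b y = 0 ∧ g₀ b y = 0 := by
    intro b hb y
    have h1 : ∑ y, f b y = 0 := by
      have := hb.2
      simp only [hD] at this
      omega
    exact ⟨Finset.sum_eq_zero_iff.1 h1 y (mem_univ _), (hM _ hb.1.1).2.2.1 b y⟩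
  have not_src_of_pend : ∀ {b}, Pend b → ¬ Src b := fun h h' => h'.2.1 h.2
  have sum_s : ∀ x, ¬ W x → ∑ y, s x y = if Src x then 1 else 0 := by
    intro x hx
    have : ∀ y, s x y = if Src x ∧ y = ω x then 1 else 0 := by
      intro y
      have h1 : ¬ (Src y ∧ x = ω y) := by
        rintro ⟨h, rfl⟩
        exact hx (hωα y h.1).1.1
      simp only [hs, h1, or_false]
    simp only [this]
    by_cases h : Src x <;> simp [h]
  have sum_J_true : ∀ x, χ x = true → ∑ y, J x y = if jj x then 1 else 0 := by
    intro x hx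
    have : ∀ y, J x y = if jj x ∧ y = α x then 1 else 0 := by
      intro y
      have h1 : ¬ (jj y ∧ x = α y) := by
        rintro ⟨h, rfl⟩
        exact hχ _ _ (hωα y h.1.1).2.1 ((hPendχ h.1).trans hx.symm)
      simp only [hJ, h1, or_false]
    simp only [this]
    by_cases h : jj x <;> simp [h]
  have sum_J_false : ∀ x, χ x = false → ∑ y, J x y =
      if jj (β (κ x)) ∧ x = α (β (κ x)) then 1 else 0 := by
    intro x hx
    have : ∀ y, J x y = if (jj (β (κ x)) ∧ x = α (β (κ x))) ∧ y = β (κ x) then 1 else 0 := by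
      intro y
      have h1 : ¬ (jj x ∧ y = α x) := by
        rintro ⟨h, rfl⟩
        have := hPendχ h.1
        simp [hx] at this
      have h2 : (jj y ∧ x = α y) ↔ (jj (β (κ x)) ∧ x = α (β (κ x))) ∧ y = β (κ x) := by
        constructor
        · rintro ⟨h, hxy⟩
          have h3 := (hωα y h.1.1).2
          rw [← hxy] at h3
          have h4 : y = β (κ x) := hκadj h3 ▸ h.1.1.2
          exact ⟨h4 ▸ ⟨h, hxy⟩, h4⟩
        · rintro ⟨h, rfl⟩
          exact h
      simp only [hJ, h1, false_or, h2]
    simp only [this]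
    by_cases h : jj (β (κ x)) ∧ x = α (β (κ x))
    · rw [if_pos h, Finset.sum_eq_single (β (κ x))]
      · exact if_pos ⟨h, rfl⟩
      · exact fun y _ hy => if_neg fun h' => hy h'.2
      · exact fun h' => absurd (mem_univ _) h'
    · rw [if_neg h]
      exact Finset.sum_eq_zero fun y _ => if_neg fun h' => h h'.1
  have jj_marked : ∀ {x}, χ x = false → jj (β (κ x)) ∧ x = α (β (κ x)) → marked (κ x) ∧ Pend (β (κ x)) := by
    rintro x hx ⟨h1, h2⟩
    have h3 := (hωα _ h1.1.1).2
    rw [← h2] at h3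
    exact ⟨hκadj h3 ▸ h1.1.1.1, h1.1⟩
  have sum_S : ∀ x, ¬ W x → ¬ Pend x → ∑ y, S x y = 0 := by
    intro x h1 h2
    refine Finset.sum_eq_zero fun y _ => ?_
    by_contra h
    rcases (Sa x y h).2 with h | h
    · exact h2 h.1
    · exact h1 h.1
  have W_zero : ∀ x, W x → ∑ y, f x y = 0 ∧ ∑ y, g₀ x y = 0 ∧ ∑ y, J x y = 0 := by
    intro x hx
    refine ⟨Finset.sum_eq_zero fun y _ => ?_, Finset.sum_eq_zero fun y _ => ?_,
      Finset.sum_eq_zero fun y _ => ?_⟩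
    · by_contra h
      exact (fga x y (by omega)).2.1 hx
    · by_contra h
      exact (fga x y (by omega)).2.1 hx
    · by_contra h
      exact (JΓ x y h).1.2.1 hx
  have g₀marked : ∀ x, marked (κ x) → ∑ y, g₀ x y = 0 := fun x hx =>
    Finset.sum_eq_zero fun y _ => (hM _ hx).2.2.1 x y
  set g : V → V → ℕ := fun x y => g₀ x y + s x y + S x y + J x y with hg
  have sum_g : ∀ x, ∑ y, g x y = ∑ y, g₀ x y + ∑ y, s x y + ∑ y, S x y + ∑ y, J x y := fun x => by
    simp only [hg, Finset.sum_add_distrib]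
  have s_le : ∀ x y, s x y ≤ 1 := fun x y => by
    simp only [hs]
    split_ifs <;> simp
  have J_le : ∀ x y, J x y ≤ 1 := fun x y => by
    simp only [hJ]
    split_ifs <;> simp
  set d₂ : V → ℕ := fun x => (if χ x then c x else 0) + ∑ y, f x y with hd₂
  set d₃ : V → ℕ := fun x => (if χ x then 0 else c x) + ∑ y, g x y with hd₃
  have d₂W : ∀ x, W x → d₂ x = 0 := fun x hx => by simp [hd₂, hx.1, (W_zero x hx).1]
  have d₂D : ∀ x, ¬ W x → d₂ x = D x := fun x hx => by
    by_cases h : χ x = true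
    · simp [hd₂, hD, h]
    · rw [Bool.not_eq_true] at h
      simp [hd₂, hD, h, hcW hx h]
  have d₃W : ∀ x, W x → d₃ x = c x + ∑ y, s x y + ∑ y, S x y := fun x hx => by
    simp only [hd₃, sum_g, W_zero x hx, hx.1]
    simp [add_assoc]
  have d₃B : ∀ x, χ x = true → d₃ x = ∑ y, g₀ x y + (if Src x then 1 else 0) + ∑ y, S x y +
      if jj x then 1 else 0 := fun x hx => by
    simp only [hd₃, sum_g, sum_s x (hWt hx), sum_J_true x hx, hx]
    simp
  have d₃A : ∀ x, χ x = false → ¬ W x → d₃ x = ∑ y, g₀ x y +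
      if jj (β (κ x)) ∧ x = α (β (κ x)) then 1 else 0 := fun x hx hxW => by
    have h1 : ¬ Src x := fun h => by
      have := hSrcχ h
      simp [hx] at this
    have h2 : ¬ Pend x := fun h => by
      have := hPendχ h
      simp [hx] at this
    simp only [hd₃, sum_g, sum_s x hxW, sum_J_false x hx, hx, hcW hxW hx, sum_S x hxW h2, h1]
    simp
  have even_A : ∀ x, χ x = false → ¬ W x → marked (κ x) → Even (d₂ x) := by
    intro x hx hxW hm
    have h1 := (hM _ hm).2.2.2 x rfl (by
      intro h
      have := (hM _ hm).2.1.1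
      rw [← h, hx] at this
      simp at this)
    rw [hx] at h1
    rw [d₂D x hxW]
    simpa [hD, hcW hxW hx] using h1
  have odd_B : ∀ x, χ x = true → marked (κ x) → ¬ isβ x → Odd (d₂ x) := by
    intro x hx hm hxβ
    have h1 := (hM _ hm).2.2.2 x rfl fun h => hxβ ⟨hm, h⟩
    rw [hx, if_pos rfl] at h1
    have h2 : ∑ y, F (κ x) x y + (c x + 1) = d₂ x + 1 := by
      rw [d₂D x (hWt hx)]
      simp only [hD, hf]
      ring
    rw [h2, Nat.even_add_one, Nat.not_even_iff_odd] at h1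
    exact h1
  have unmarked_B : ∀ x, χ x = true → ¬ marked (κ x) → d₃ x = ∑ y, g₀ x y := by
    intro x hx hm
    have h1 : ¬ Pend x := fun h => hm h.1.1
    have h2 : ¬ Src x := fun h => hm h.1.1
    have h3 : ¬ jj x := fun h => h1 h.1
    rw [d₃B x hx, if_neg h3, if_neg h2, sum_S x (hWt hx) h1]
    simp
  have unmarked_A : ∀ x, χ x = false → ¬ W x → ¬ marked (κ x) → d₃ x = ∑ y, g₀ x y := by
    intro x hx hxW hm
    have h1 : ¬ (jj (β (κ x)) ∧ x = α (β (κ x))) := fun h => hm (jj_marked hx h).1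
    rw [d₃A x hx hxW, if_neg h1, add_zero]
  have marked_B : ∀ x, χ x = true → marked (κ x) → ¬ Pend x → d₃ x = if Src x then 1 else 0 := by
    intro x hx hm h1
    have h3 : ¬ jj x := fun h => h1 h.1
    rw [d₃B x hx, if_neg h3, sum_S x (hWt hx) h1, g₀marked x hm]
    simp
  have pend_B : ∀ x, Pend x → d₃ x = ∑ y, S x y + if jj x then 1 else 0 := by
    intro x h
    rw [d₃B x (hPendχ h), g₀marked x h.1.1, if_neg (not_src_of_pend h)]
    simp
  have pend_d₂ : ∀ x, Pend x → d₂ x = 0 := fun x h => by rw [d₂D x (hWt (hPendχ h)), h.2]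
  have main : ∀ x y, χ x = true → H.Adj x y → d₂ x ≠ d₂ y ∨ d₃ x ≠ d₃ y := by
    intro x y hx hxy
    have hy : χ y = false := by
      have := hχ x y hxy
      rw [hx] at this
      simpa using this.symm
    by_cases hyW : W y
    · by_cases hp : Pend x
      · right
        have hQxy : Q.Adj x y := ⟨hxy, Or.inl ⟨hp, hyW⟩⟩
        have h1 := SW y hyW
        rw [← Sπ x y hQxy, ← d₃W y hyW] at h1
        intro h
        rw [← h, pend_B x hp] at h1
        by_cases hj : jj x
        · have h2 := hj.2
          rw [if_pos hj, show ∑ y, S x y + 1 + π x = (∑ y, S x y + π x) + 1 by ring,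
            Nat.even_add_one] at h1
          exact h1 h2
        · rw [if_neg hj, add_zero] at h1
          exact hj ⟨hp, h1⟩
      · have h3 : d₃ y ≠ 0 := by
          rw [d₃W y hyW]
          have := hyW.2
          omega
        by_cases hm : marked (κ x)
        · by_cases hsx : Src x
          · left
            rw [d₂W y hyW, d₂D x (hWt hx)]
            exact hsx.2.1
          · right
            rw [marked_B x hx hm hp, if_neg hsx]
            exact h3.symm
        · right
          rw [unmarked_B x hx hm, Finset.sum_eq_zero fun z _ => ?_]
          · exact h3.symm
          · by_contra h
            exact hm ⟨x, rfl, hx, ⟨y, hyW, hxy⟩, z, fga x z (by omega)⟩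
    · have hxyΓ : Γ.Adj x y := ⟨hxy, hWt hx, hyW⟩
      have hκxy := hκadj hxyΓ
      by_cases hm : marked (κ x)
      · have hmy : marked (κ y) := hκxy ▸ hm
        have hey := even_A y hy hyW hmy
        by_cases hxβ : isβ x
        · by_cases ho : Odd (D x)
          · left
            intro h
            rw [← d₂D x (hWt hx), h, ← Nat.not_even_iff_odd] at ho
            exact ho hey
          · rw [Nat.not_odd_iff_even] at ho
            have hβy : β (κ y) = x := by rw [← hκxy, ← hxβ.2]
            right
            rw [d₃A y hy hyW, g₀marked y hmy, zero_add, hβy]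
            by_cases h0 : D x = 0
            · have hp : Pend x := ⟨hxβ, h0⟩
              have := SP x hp
              rw [pend_B x hp]
              by_cases hj : jj x
              · rw [if_pos hj]
                split_ifs <;> omega
              · simp only [hj, false_and, if_false]
                omega
            · have hp : ¬ Pend x := fun h => h0 h.2
              have hj : ¬ jj x := fun h => hp h.1
              have hsx : Src x := ⟨hxβ, h0, ho⟩
              rw [marked_B x hx hm hp, if_pos hsx]
              simp [hj]
        · left
          have := odd_B x hx hm hxβ
          intro h
          rw [h, ← Nat.not_even_iff_odd] at this
          exact this hey
      · have hmy : ¬ marked (κ y) := hκxy ▸ hm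
        rw [unmarked_B x hx hm, unmarked_A y hy hyW hmy, d₂D x (hWt hx), d₂D y hyW]
        have := (hU _ hm).2 x y rfl hxyΓ
        simp only [hD, hf, hg₀, ← hκxy]
        exact this
  refine ⟨f, g, fun x y => (hFs x y).1, fun x y => ?_, fun x y => ?_, fun x y h => ?_, d₂, d₃,
    fun _ => rfl, fun _ => rfl, fun x => ?_, fun x y hxy => ?_⟩
  · simp only [hg, hs, hJ, (hFs x y).2, Ss x y]
    congr 2
    · congr 2
      rw [or_comm]
    · rw [or_comm]
  · simp only [hg]
    have h1 := fg1 x y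
    have h2 := s_le x y
    have h3 := S1 x y
    have h4 := J_le x y
    by_cases hw : W x ∨ W y
    · have e1 : f x y + g₀ x y = 0 := by
        by_contra h
        have := fga x y h
        exact hw.elim this.2.1 this.2.2
      have e2 : J x y = 0 := by
        by_contra h
        have := (JΓ x y h).1
        exact hw.elim this.2.1 this.2.2
      have e3 : s x y = 0 ∨ S x y = 0 := by
        by_contra! h
        have h5 := (sW x y h.1).2
        have h6 := (Sa x y h.2).2
        rcases h5 with h5 | h5 <;> rcases h6 with h6 | h6
        · exact not_src_of_pend h6.1 h5.1
        · exact hWt (hSrcχ h5.1) h6.1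
        · exact hWt (hPendχ h6.1) h5.1
        · exact not_src_of_pend h6.2 h5.2
      omega
    · push Not at hw
      have e1 : s x y = 0 := by
        by_contra h
        rcases (sW x y h).2 with h | h
        · exact hw.2 h.2
        · exact hw.1 h.1
      have e2 : S x y = 0 := by
        by_contra h
        rcases (Sa x y h).2 with h | h
        · exact hw.2 h.2
        · exact hw.1 h.1
      have e3 : J x y = 0 ∨ (f x y = 0 ∧ g₀ x y = 0) := by
        by_contra! h
        rcases (JΓ x y h.1).2 with h' | h'
        · have := zero_of_pend h'.1 y
          exact h.2 this.1 this.2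
        · have := zero_of_pend h'.1 x
          rw [(hFs y x).1, (hFs y x).2] at this
          exact h.2 this.1 this.2
      omega
  · by_cases h1 : f x y + g₀ x y = 0
    · by_cases h2 : s x y = 0
      · by_cases h3 : S x y = 0
        · refine (JΓ x y ?_).1.1
          simp only [hg] at h
          omega
        · exact (Sa x y h3).1
      · exact (sW x y h2).1
    · exact (fga x y h1).1
  · by_cases hxW : W x
    · exact Or.inl (d₂W x hxW)
    by_cases hm : marked (κ x)
    · by_cases hx : χ x = true
      · by_cases hp : Pend x
        · exact Or.inl (pend_d₂ x hp)
        · rw [marked_B x hx hm hp, d₂D x hxW]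
          by_cases hsx : Src x
          · exact Or.inr (Or.inr ⟨if_pos hsx, hsx.2.2⟩)
          · exact Or.inr (Or.inl (if_neg hsx))
      · rw [Bool.not_eq_true] at hx
        rw [d₃A x hx hxW, g₀marked x hm, zero_add]
        split_ifs
        · exact Or.inr (Or.inr ⟨rfl, even_A x hx hxW hm⟩)
        · exact Or.inr (Or.inl rfl)
    · have h1 := (hU _ hm).1 x rfl
      have h2 : d₃ x = ∑ y, g₀ x y := by
        by_cases hx : χ x = true
        · exact unmarked_B x hx hm
        · rw [Bool.not_eq_true] at hx
          exact unmarked_A x hx hxW hm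
      rw [h2, d₂D x hxW]
      rcases h1 with h | h | h
      · exact Or.inr (Or.inl h)
      · exact Or.inl h
      · exact Or.inr (Or.inr h)
  · by_cases hx : χ x = true
    · exact main x y hx hxy
    · have hy : χ y = true := by
        have := hχ x y hxy
        revert this hx
        cases χ x <;> cases χ y <;> simp
      rcases main y x hy hxy.symm with h | h
      · exact Or.inl h.symm
      · exact Or.inr h.symm


/-! ### The layered colouring. -/

/-- A proper colouring with least sum of colours works: a missing smaller colour could be used to
recolour. -/
theorem exists_greedy_colouring {V : Type*} [Fintype V] (Γ : SimpleGraph V) :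
    ∃ col : V → ℕ, (∀ x y, Γ.Adj x y → col x ≠ col y) ∧
      ∀ x j, j < col x → ∃ y, Γ.Adj x y ∧ col y = j := by
  classical
  have hex : ∃ n, ∃ col : V → ℕ, (∀ x y, Γ.Adj x y → col x ≠ col y) ∧ ∑ x, col x = n :=
    ⟨_, fun x => (Fintype.equivFin V x : ℕ), fun x y h h' =>
      h.ne ((Fintype.equivFin V).injective (Fin.ext h')), rfl⟩
  obtain ⟨col, hcol, hsum⟩ := Nat.find_spec hex
  refine ⟨col, hcol, fun x j hj => ?_⟩
  by_contra! hno
  refine Nat.find_min hex (m := ∑ y, Function.update col x j y) ?_ ⟨_, fun y z h => ?_, rfl⟩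
  · rw [← hsum]
    refine Finset.sum_lt_sum (fun y _ => ?_) ⟨x, mem_univ _, by simpa using hj⟩
    by_cases h : y = x
    · subst h; simpa using hj.le
    · simp [h]
  · by_cases hy : y = x
    · subst hy
      have hz : z ≠ y := h.ne'
      simpa [hz] using (hno z h).symm
    · by_cases hz : z = x
      · subst hz
        simpa [hy] using hno y h.symm
      · simpa [hy, hz] using hcol y z h

/-- The subgraph of the edges with both ends in `L`. -/
def edgesWithin {V : Type*} (G : SimpleGraph V) (L : V → Prop) : SimpleGraph V where
  Adj x y := G.Adj x y ∧ L x ∧ L y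
  symm := ⟨fun _ _ h => ⟨h.1.symm, h.2.2, h.2.1⟩⟩
  loopless := ⟨fun x h => G.loopless.irrefl x h.1⟩

/-- Take `L` of largest size. If no component contained neighbours of `x` of both colours, swapping
the colours in each component with a false neighbour of `x` would make all its neighbours true, and
`x` could join `L` as false. -/
theorem exists_maximal_bipartite {V : Type*} [Fintype V] (G : SimpleGraph V) :
    ∃ (L : V → Prop) (χ : V → Bool), (∀ x y, (G.edgesWithin L).Adj x y → χ x ≠ χ y) ∧
      ∀ x, ¬ L x → ∃ p q, L p ∧ L q ∧ G.Adj x p ∧ G.Adj x q ∧ (G.edgesWithin L).Reachable p q ∧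
        χ p = true ∧ χ q = false := by
  classical
  obtain ⟨L, hL, hmax⟩ := Finset.exists_max_image
    (univ.filter fun L : Finset V => ∃ χ : V → Bool,
      ∀ x y, (G.edgesWithin (· ∈ L)).Adj x y → χ x ≠ χ y) Finset.card
    ⟨∅, by simp [edgesWithin]⟩
  simp only [mem_filter, mem_univ, true_and] at hL hmax
  obtain ⟨χ, hχ⟩ := hL
  refine ⟨(· ∈ L), χ, hχ, fun x hx => ?_⟩
  by_contra! hno
  set H := G.edgesWithin (· ∈ L) with hH
  set fl : V → Prop := fun v => ∃ q, q ∈ L ∧ G.Adj x q ∧ χ q = false ∧ H.Reachable v q with hfl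
  have hflH : ∀ v w, H.Adj v w → (fl v ↔ fl w) := fun v w h =>
    ⟨fun ⟨q, h1, h2, h3, h4⟩ => ⟨q, h1, h2, h3, h.symm.reachable.trans h4⟩,
      fun ⟨q, h1, h2, h3, h4⟩ => ⟨q, h1, h2, h3, h.reachable.trans h4⟩⟩
  have hnb : ∀ p, p ∈ L → G.Adj x p → (xor (χ p) (decide (fl p))) = true := by
    intro p hp hxp
    cases h : χ p
    · have : fl p := ⟨p, hp, hxp, h, .refl _⟩
      simp [this]
    · have : ¬ fl p := by
        rintro ⟨q, h1, h2, h3, h4⟩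
        exact hno p q hp h1 hxp h2 h4 h h3
      simp [this]
  refine absurd (hmax (insert x L) ⟨fun v => if v = x then false else xor (χ v) (decide (fl v)), ?_⟩)
    (by rw [Finset.card_insert_of_notMem hx]; omega)
  rintro v w ⟨hvw, hv, hw⟩
  rw [mem_insert] at hv hw
  rcases hv with rfl | hv <;> rcases hw with rfl | hw
  · exact (G.loopless.irrefl _ hvw).elim
  · have h1 : w ≠ v := hvw.ne'
    simp [h1, hnb w hw hvw]
  · have h1 : v ≠ w := hvw.ne
    simp [h1, hnb v hv hvw.symm]
  · have h1 : v ≠ x := fun h => hx (h ▸ hv)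
    have h2 : w ≠ x := fun h => hx (h ▸ hw)
    have h3 : H.Adj v w := ⟨hvw, hv, hw⟩
    have h4 := hχ v w h3
    simp only [h1, h2, if_false, hflH v w h3]
    simpa using h4

/-- A proper colouring with the first two classes inducing a maximal bipartite subgraph `H`.  The relation
`Φ` selects for components of `H` a neighbour `x` outside `H`, whose colour has the parity of
that of its neighbour in the component. -/
theorem exists_layered_colouring {V : Type*} [Fintype V] (G : SimpleGraph V) :
    ∃ (col : V → ℕ) (Y : V → ℕ → V) (Φ : V → V → Prop), (∀ x y, G.Adj x y → col x ≠ col y) ∧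
      (∀ x, 1 ≤ col x) ∧
      (∀ x j, 3 ≤ col x → 1 ≤ j → j < col x → G.Adj x (Y x j) ∧ col (Y x j) = j) ∧
      (∀ x, 3 ≤ col x → (G.edgesWithin (col · ≤ 2)).Reachable (Y x 1) (Y x 2)) ∧
      (∀ x k, Φ x k → G.Adj x k ∧ 3 ≤ col x ∧ col k ≤ 2 ∧ col k % 2 = col x % 2 ∧
        ¬ (G.edgesWithin (col · ≤ 2)).Reachable (Y x 1) k) ∧
      ∀ u z x, col u ≤ 2 → (G.edgesWithin (col · ≤ 2)).Reachable u z → G.Adj x z → 3 ≤ col x →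
        ∃ y, 3 ≤ col y ∧ ((G.edgesWithin (col · ≤ 2)).Reachable u (Y y 1) ∨
          ∃ k, Φ y k ∧ (G.edgesWithin (col · ≤ 2)).Reachable u k) := by
  classical
  obtain ⟨L, χ, hχ, hL⟩ := G.exists_maximal_bipartite
  obtain ⟨col', hcol', hgreedy⟩ := (G.edgesWithin (fun x => ¬ L x)).exists_greedy_colouring
  set H := G.edgesWithin L with hH
  have hLreach : ∀ u z, H.Reachable u z → L u → L z := by
    rintro u z ⟨p⟩ hu
    induction p with
    | nil => exact hu
    | cons h p ih => exact ih h.2.2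
  have hsel : ∀ C : H.ConnectedComponent, ∃ k x, (∃ k x, H.connectedComponentMk k = C ∧ L k ∧ G.Adj x k ∧ ¬ L x) →
      H.connectedComponentMk k = C ∧ L k ∧ G.Adj x k ∧ ¬ L x := by
    intro C
    by_cases h : ∃ k x, H.connectedComponentMk k = C ∧ L k ∧ G.Adj x k ∧ ¬ L x
    · obtain ⟨k, x, h⟩ := h
      exact ⟨k, x, fun _ => h⟩
    · obtain ⟨k, -⟩ := C.exists_rep
      exact ⟨k, k, fun h' => absurd h' h⟩
  choose kk xx hkx using hsel
  set κ : V → H.ConnectedComponent := fun v => H.connectedComponentMk v with hκ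
  -- The colours 1 and 2 can be swapped in each component separately. The swap gives the selected
  -- vertex `kk C` the parity of the colour of its outside neighbour `xx C`, so that a forced edge
  -- between them falls in the adjustable count at `xx C`.
  set flip : H.ConnectedComponent → Bool := fun C => xor (χ (kk C)) (decide (Even (col' (xx C) + 3))) with hflip
  set ψ : V → Bool := fun v => xor (χ v) (flip (κ v)) with hψ
  have hψk : ∀ k, k = kk (κ k) → ψ k = decide (Even (col' (xx (κ k)) + 3)) := by
    intro k hk
    simp only [hψ, hflip, ← hk]
    simp
  have hψne : ∀ v w, κ v = κ w → χ v ≠ χ w → ψ v ≠ ψ w := by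
    intro v w h h'
    simp only [hψ, h]
    simpa using h'
  set col : V → ℕ := fun v => if L v then (if ψ v then 2 else 1) else col' v + 3 with hcol
  have colL : ∀ v, L v → col v = if ψ v then 2 else 1 := fun v h => by simp [hcol, h]
  have colU : ∀ v, ¬ L v → col v = col' v + 3 := fun v h => by simp [hcol, h]
  have colL2 : ∀ v, col v ≤ 2 ↔ L v := by
    intro v
    by_cases h : L v
    · rw [colL v h]
      split_ifs <;> simp [h]
    · rw [colU v h]
      simp [h]
  have colU3 : ∀ v, 3 ≤ col v ↔ ¬ L v := fun v => by
    rw [← colL2]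
    omega
  have hHcol : G.edgesWithin (col · ≤ 2) = H := by
    simp only [colL2, hH]
  have hlow : ∀ x, ∃ a b, ¬ L x → (G.Adj x a ∧ L a ∧ col a = 1) ∧ (G.Adj x b ∧ L b ∧ col b = 2) ∧
      H.Reachable a b := by
    intro x
    by_cases hx : L x
    · exact ⟨x, x, fun h => absurd hx h⟩
    obtain ⟨p, q, hp, hq, hxp, hxq, hpq, h1, h2⟩ := hL x hx
    have h3 := hψne p q (ConnectedComponent.sound hpq) (by simp [h1, h2])
    cases h : ψ p
    · have h' : ψ q = true := by
        rw [h] at h3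
        simpa using h3.symm
      exact ⟨p, q, fun _ => ⟨⟨hxp, hp, by simp [colL p hp, h]⟩, ⟨hxq, hq, by simp [colL q hq, h']⟩, hpq⟩⟩
    · have h' : ψ q = false := by
        rw [h] at h3
        simpa using h3.symm
      exact ⟨q, p, fun _ => ⟨⟨hxq, hq, by simp [colL q hq, h']⟩, ⟨hxp, hp, by simp [colL p hp, h]⟩, hpq.symm⟩⟩
  choose a b hab using hlow
  have hup : ∀ x j, ∃ y, ¬ L x → 3 ≤ j → j < col x → G.Adj x y ∧ col y = j := by
    intro x j
    by_cases h : ¬ L x ∧ 3 ≤ j ∧ j < col x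
    · obtain ⟨h1, h2, h3⟩ := h
      rw [colU x h1] at h3
      obtain ⟨y, hy, hj⟩ := hgreedy x (j - 3) (by omega)
      exact ⟨y, fun _ _ _ => ⟨hy.1, by rw [colU y hy.2.2]; omega⟩⟩
    · exact ⟨x, fun h1 h2 h3 => absurd ⟨h1, h2, h3⟩ h⟩
  choose y hy using hup
  set Y : V → ℕ → V := fun x j => if j = 1 then a x else if j = 2 then b x else y x j with hY
  have hY1 : ∀ x, Y x 1 = a x := fun x => by simp [hY]
  have hY2 : ∀ x, Y x 2 = b x := fun x => by simp [hY]
  refine ⟨col, Y, fun x k => k = kk (κ k) ∧ x = xx (κ k) ∧ L k ∧ G.Adj x k ∧ ¬ L x ∧ ¬ H.Reachable (Y x 1) k,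
    fun v w hvw => ?_, fun v => ?_, fun x j hx hj hj' => ?_, fun x hx => ?_, ?_, ?_⟩
  · by_cases hv : L v
    · by_cases hw : L w
      · have hadj : H.Adj v w := ⟨hvw, hv, hw⟩
        have h3 := hψne v w (ConnectedComponent.sound hadj.reachable) (hχ v w hadj)
        rw [colL v hv, colL w hw]
        revert h3
        cases ψ v <;> cases ψ w <;> simp
      · have := (colL2 v).2 hv
        have := (colU3 w).2 hw
        omega
    · by_cases hw : L w
      · have := (colL2 w).2 hw
        have := (colU3 v).2 hv
        omega
      · have := hcol' v w ⟨hvw, hv, hw⟩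
        rw [colU v hv, colU w hw]
        omega
  · by_cases hv : L v
    · rw [colL v hv]
      split_ifs <;> simp
    · rw [colU v hv]
      omega
  · rw [colU3] at hx
    have h1 := hab x hx
    by_cases h : j = 1
    · subst h
      rw [hY1]
      exact ⟨h1.1.1, h1.1.2.2⟩
    by_cases h' : j = 2
    · subst h'
      rw [hY2]
      exact ⟨h1.2.1.1, h1.2.1.2.2⟩
    · have : Y x j = y x j := by simp [hY, h, h']
      rw [this]
      exact hy x j hx (by omega) hj'
  · rw [hHcol, hY1, hY2]
    exact (hab x ((colU3 x).1 hx)).2.2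
  · rintro x k ⟨h1, h2, h3, h4, h5, h6⟩
    refine ⟨h4, (colU3 x).2 h5, (colL2 k).2 h3, ?_, by rwa [hHcol]⟩
    rw [colL k h3, hψk k h1, colU x h5, ← h2]
    by_cases he : Even (col' x + 3)
    · simp [he, Nat.even_iff.1 he]
    · simp [he, Nat.odd_iff.1 (Nat.not_even_iff_odd.1 he)]
  · intro u z x hu huz hxz hx
    rw [hHcol] at huz ⊢
    have hLu := (colL2 u).1 hu
    have hC := hkx (κ u) ⟨z, x, (ConnectedComponent.sound huz).symm, hLreach u z huz hLu, hxz, (colU3 x).1 hx⟩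
    have hku : H.Reachable u (kk (κ u)) := (ConnectedComponent.exact hC.1).symm
    refine ⟨xx (κ u), (colU3 _).2 hC.2.2.2, ?_⟩
    by_cases hr : H.Reachable (Y (xx (κ u)) 1) (kk (κ u))
    · exact Or.inl (hku.trans hr.symm)
    · have hC1 : κ (kk (κ u)) = κ u := hC.1
      exact Or.inr ⟨kk (κ u), ⟨by rw [hC1], by rw [hC1], hC.2.1, hC.2.2.1, hC.2.2.2, hr⟩, hku⟩


/-! ### Edges sent down from the upper colours. -/

/-- `(i - 1) / 2` is the number of positive colours below `i` of the same parity. Adding 0 or 1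
fixes the parity; adding 2 is needed only when `s = 0` and 0 has the right parity, which does not
occur for `i = 3, 4`. -/
theorem exists_add_parity {i : ℕ} (hi : 3 ≤ i) (s : ℕ) :
    ∃ J ≤ (i - 1) / 2, s + J ≠ 0 ∧ Even (s + J + (i / 2 + i + 1)) := by
  by_cases h : Even (s + (i / 2 + i + 1))
  · by_cases hs : s = 0
    · subst hs
      rw [Nat.even_iff] at h
      have h5 : 5 ≤ i := by
        by_contra h5
        have : i = 3 ∨ i = 4 := by omega
        rcases this with rfl | rfl <;> simp at h
      exact ⟨2, by omega, by omega, by rw [Nat.even_iff]; omega⟩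
    · exact ⟨0, by omega, by omega, h⟩
  · rw [Nat.even_iff] at h
    exact ⟨1, by omega, by omega, by rw [Nat.even_iff]; omega⟩

theorem exists_out_set {V : Type*} [Fintype V] [DecidableEq V] (G : SimpleGraph V) (col : V → ℕ)
    (Y : ℕ → V) (F : Finset V) (x : V) (hx : 3 ≤ col x)
    (hY : ∀ j, 1 ≤ j → j < col x → G.Adj x (Y j) ∧ col (Y j) = j)
    (hF : ∀ k ∈ F, G.Adj x k ∧ col k ≤ 2 ∧ col k % 2 = col x % 2 ∧ k ≠ Y 1 ∧ k ≠ Y 2) (s : ℕ) :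
    ∃ O : Finset V, (∀ y ∈ O, G.Adj x y ∧ col y < col x) ∧ F ⊆ O ∧ (Y 1 ∈ O ∨ Y 2 ∈ O) ∧
      (O.filter fun y => col y % 2 ≠ col x % 2).card = col x / 2 ∧
      s + (O.filter fun y => col y % 2 = col x % 2).card ≠ 0 ∧
      Even (s + (O.filter fun y => col y % 2 = col x % 2).card + (col x / 2 + col x + 1)) := by
  obtain ⟨J, hJ, hJ0, hJe⟩ := exists_add_parity hx (s + F.card)
  set i := col x with hi
  -- `A` takes one neighbour of each smaller colour of opposite parity, hence `i / 2` of them,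
  -- including `Y 1` or `Y 2`. `B` takes `J` neighbours of the same parity as `i`, from the top
  -- down.
  set A : Finset V := (range (i / 2)).image fun k => Y (i - 1 - 2 * k) with hA
  set B : Finset V := (range J).image fun k => Y (i - 2 - 2 * k) with hB
  have hAm : ∀ y ∈ A, ∃ k < i / 2, y = Y (i - 1 - 2 * k) := by
    intro y hy
    obtain ⟨k, hk, rfl⟩ := mem_image.1 hy
    exact ⟨k, mem_range.1 hk, rfl⟩
  have hBm : ∀ y ∈ B, ∃ k < J, y = Y (i - 2 - 2 * k) := by
    intro y hy
    obtain ⟨k, hk, rfl⟩ := mem_image.1 hy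
    exact ⟨k, mem_range.1 hk, rfl⟩
  have hAp : ∀ y ∈ A, col y % 2 ≠ i % 2 ∧ G.Adj x y ∧ col y < i := by
    intro y hy
    obtain ⟨k, hk, rfl⟩ := hAm y hy
    have := hY (i - 1 - 2 * k) (by omega) (by omega)
    rw [this.2]
    exact ⟨by omega, this.1, by omega⟩
  have hBp : ∀ y ∈ B, col y % 2 = i % 2 ∧ G.Adj x y ∧ col y < i := by
    intro y hy
    obtain ⟨k, hk, rfl⟩ := hBm y hy
    have := hY (i - 2 - 2 * k) (by omega) (by omega)
    rw [this.2]
    exact ⟨by omega, this.1, by omega⟩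
  have hAc : A.card = i / 2 := by
    rw [hA, Finset.card_image_of_injOn, card_range]
    intro k hk l hl h
    simp only [coe_range, Set.mem_Iio] at hk hl
    have h1 := (hY (i - 1 - 2 * k) (by omega) (by omega)).2
    have h2 := (hY (i - 1 - 2 * l) (by omega) (by omega)).2
    simp only at h
    rw [h, h2] at h1
    omega
  have hBc : B.card = J := by
    rw [hB, Finset.card_image_of_injOn, card_range]
    intro k hk l hl h
    simp only [coe_range, Set.mem_Iio] at hk hl
    have h1 := (hY (i - 2 - 2 * k) (by omega) (by omega)).2
    have h2 := (hY (i - 2 - 2 * l) (by omega) (by omega)).2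
    simp only at h
    rw [h, h2] at h1
    omega
  have hdisj : Disjoint F B := by
    rw [Finset.disjoint_left]
    intro y hyF hyB
    obtain ⟨k, hk, rfl⟩ := hBm y hyB
    have h1 := (hY (i - 2 - 2 * k) (by omega) (by omega)).2
    obtain ⟨-, h2, -, h3, h4⟩ := hF _ hyF
    rw [h1] at h2
    have : i - 2 - 2 * k = 1 ∨ i - 2 - 2 * k = 2 := by omega
    rcases this with h | h
    · rw [h] at h3; exact h3 rfl
    · rw [h] at h4; exact h4 rfl
  have e1 : ((A ∪ (F ∪ B)).filter fun y => col y % 2 ≠ i % 2) = A := by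
    ext y
    simp only [mem_filter, mem_union]
    constructor
    · rintro ⟨h | h | h, h'⟩
      · exact h
      · exact absurd (hF y h).2.2.1 h'
      · exact absurd (hBp y h).1 h'
    · exact fun h => ⟨Or.inl h, (hAp y h).1⟩
  have e2 : ((A ∪ (F ∪ B)).filter fun y => col y % 2 = i % 2) = F ∪ B := by
    ext y
    simp only [mem_filter, mem_union]
    constructor
    · rintro ⟨h | h, h'⟩
      · exact absurd h' (hAp y h).1
      · exact h
    · rintro (h | h)
      · exact ⟨Or.inr (Or.inl h), (hF y h).2.2.1⟩
      · exact ⟨Or.inr (Or.inr h), (hBp y h).1⟩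
  refine ⟨A ∪ (F ∪ B), fun y hy => ?_, fun y hy => by simp [hy], ?_, ?_, ?_, ?_⟩
  · rw [mem_union, mem_union] at hy
    rcases hy with h | h | h
    · exact (hAp y h).2
    · have := hF y h
      exact ⟨this.1, by omega⟩
    · exact (hBp y h).2
  · have hk : ∀ j, (j = 1 ∨ j = 2) → j % 2 ≠ i % 2 → Y j ∈ A ∪ (F ∪ B) := by
      intro j hj hji
      refine mem_union_left _ (mem_image.2 ⟨(i - 1 - j) / 2, mem_range.2 (by omega), ?_⟩)
      congr 1
      omega
    rcases Nat.even_or_odd i with h | h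
    · exact Or.inl (hk 1 (Or.inl rfl) (by rw [Nat.even_iff] at h; omega))
    · exact Or.inr (hk 2 (Or.inr rfl) (by rw [Nat.odd_iff] at h; omega))
  · rw [e1, hAc]
  · rw [e2, Finset.card_union_of_disjoint hdisj, hBc, show s + (F.card + J) = s + F.card + J by ring]
    exact hJ0
  · rw [e2, Finset.card_union_of_disjoint hdisj, hBc, show s + (F.card + J) = s + F.card + J by ring]
    exact hJe

/-- The choice, for each vertex `x` of colour at least `3`, of the neighbours `O x` of smaller colour to
which the edge from `x` gets a label other than `1`. -/
theorem exists_out_sets {V : Type*} [Fintype V] [DecidableEq V] (G : SimpleGraph V) (col : V → ℕ)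
    (Y : V → ℕ → V) (F : V → Finset V)
    (hY : ∀ x j, 3 ≤ col x → 1 ≤ j → j < col x → G.Adj x (Y x j) ∧ col (Y x j) = j)
    (hF : ∀ x, ∀ k ∈ F x, G.Adj x k ∧ col k ≤ 2 ∧ col k % 2 = col x % 2 ∧ k ≠ Y x 1 ∧ k ≠ Y x 2) :
    ∃ O : V → Finset V, (∀ x, col x < 3 → O x = ∅) ∧ ∀ x, 3 ≤ col x →
      (∀ y ∈ O x, G.Adj x y ∧ col y < col x) ∧ F x ⊆ O x ∧ (Y x 1 ∈ O x ∨ Y x 2 ∈ O x) ∧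
      ((O x).filter fun y => col y % 2 ≠ col x % 2).card = col x / 2 ∧
      (univ.filter fun y => x ∈ O y).card + ((O x).filter fun y => col y % 2 = col x % 2).card ≠ 0 ∧
      Even ((univ.filter fun y => x ∈ O y).card + ((O x).filter fun y => col y % 2 = col x % 2).card +
        (col x / 2 + col x + 1)) := by
  set P : (V → Finset V) → V → Prop := fun O x =>
      (∀ y ∈ O x, G.Adj x y ∧ col y < col x) ∧ F x ⊆ O x ∧ (Y x 1 ∈ O x ∨ Y x 2 ∈ O x) ∧
      ((O x).filter fun y => col y % 2 ≠ col x % 2).card = col x / 2 ∧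
      (univ.filter fun y => x ∈ O y).card + ((O x).filter fun y => col y % 2 = col x % 2).card ≠ 0 ∧
      Even ((univ.filter fun y => x ∈ O y).card + ((O x).filter fun y => col y % 2 = col x % 2).card +
        (col x / 2 + col x + 1)) with hP
  set N := univ.sup col + 3 with hN
  have hcN : ∀ x, col x < N := fun x => by
    have := Finset.le_sup (f := col) (mem_univ x)
    omega
  -- Colours are treated in decreasing order: the number of edges received by `x` depends only on
  -- the choices at larger colours.
  have key : ∀ m, m ≤ N - 3 → ∃ O : V → Finset V, (∀ x, col x < N - m → O x = ∅) ∧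
      ∀ x, N - m ≤ col x → P O x := by
    intro m
    induction m with
    | zero =>
      intro _
      exact ⟨fun _ => ∅, fun _ _ => rfl, fun x hx => absurd (hcN x) (by omega)⟩
    | succ m ih =>
      intro hm
      obtain ⟨O, hO, hPO⟩ := ih (by omega)
      set n := N - (m + 1) with hn
      have hout : ∀ x, ∃ T : Finset V, col x = n → (∀ y ∈ T, G.Adj x y ∧ col y < col x) ∧ F x ⊆ T ∧
          (Y x 1 ∈ T ∨ Y x 2 ∈ T) ∧ (T.filter fun y => col y % 2 ≠ col x % 2).card = col x / 2 ∧
          (univ.filter fun y => x ∈ O y).card + (T.filter fun y => col y % 2 = col x % 2).card ≠ 0 ∧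
          Even ((univ.filter fun y => x ∈ O y).card + (T.filter fun y => col y % 2 = col x % 2).card +
            (col x / 2 + col x + 1)) := by
        intro x
        by_cases hx : col x = n
        · obtain ⟨T, hT⟩ := G.exists_out_set col (Y x) (F x) x (by omega) (fun j => hY x j (by omega)) (hF x)
            (univ.filter fun y => x ∈ O y).card
          exact ⟨T, fun _ => hT⟩
        · exact ⟨∅, fun h => absurd h hx⟩
      choose T hT using hout
      set O' : V → Finset V := fun x => if col x = n then T x else O x with hO'
      have hin : ∀ x, n ≤ col x → (univ.filter fun y => x ∈ O' y) = univ.filter fun y => x ∈ O y := by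
        intro x hx
        ext y
        simp only [mem_filter, mem_univ, true_and, hO']
        split_ifs with h
        · rw [hO y (by omega)]
          simp only [notMem_empty, iff_false]
          intro h'
          have := ((hT y h).1 x h').2
          omega
        · rfl
      refine ⟨O', fun x hx => ?_, fun x hx => ?_⟩
      · have h : col x ≠ n := by omega
        simp only [hO', h, if_false]
        exact hO x (by omega)
      · simp only [hP]
        rw [hin x hx]
        by_cases h : col x = n
        · have : O' x = T x := by simp [hO', h]
          rw [this]
          exact hT x h
        · have : O' x = O x := by simp [hO', h]
          rw [this]
          exact hPO x (by omega)
  obtain ⟨O, h1, h2⟩ := key (N - 3) le_rfl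
  have h3 : N - (N - 3) = 3 := by omega
  rw [h3] at h1 h2
  exact ⟨O, h1, h2⟩


/-! ### Products as exponent pairs, and the final assembly. -/

theorem IsNice.exists_adj_of_adj {V : Type*} {G : SimpleGraph V} (hG : G.IsNice) {u v : V} (h : G.Adj u v)
    (hu : ∀ w, G.Adj u w → w = v) (hv : ∀ w, G.Adj v w → w = u) : False := by
  classical
  set c := G.connectedComponentMk u with hc
  have hmem : ∀ w, G.Reachable u w → w = u ∨ w = v := by
    rintro w ⟨p⟩
    have key : ∀ (a b : V) (q : G.Walk a b), (a = u ∨ a = v) → (b = u ∨ b = v) := by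
      intro a b q
      induction q with
      | nil => exact id
      | cons hab q ih =>
        rintro (rfl | rfl)
        · exact ih (Or.inr (hu _ hab))
        · exact ih (Or.inl (hv _ hab))
    exact key u w p (Or.inl rfl)
  have hucs : u ∈ c.supp := rfl
  have hvcs : v ∈ c.supp := ConnectedComponent.sound h.symm.reachable
  have hsupp : ∀ x : c.supp, x = ⟨u, hucs⟩ ∨ x = ⟨v, hvcs⟩ := by
    rintro ⟨x, hx⟩
    rcases hmem x (ConnectedComponent.exact hx).symm with rfl | rfl
    · exact Or.inl rfl
    · exact Or.inr rfl
  have hne : (⟨v, hvcs⟩ : c.supp) ≠ ⟨u, hucs⟩ := fun h' => h.ne' (congrArg Subtype.val h')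
  refine (hG c).false ⟨⟨fun x => if x = ⟨u, hucs⟩ then 0 else 1,
    fun i => if i = 0 then ⟨u, hucs⟩ else ⟨v, hvcs⟩, fun x => ?_, fun i => ?_⟩, fun {x y} => ?_⟩
  · rcases hsupp x with rfl | rfl <;> simp [hne]
  · fin_cases i <;> simp [hne]
  · have hadj : ∀ x y : c.supp, c.toSimpleGraph.Adj x y ↔ G.Adj x y := fun _ _ => Iff.rfl
    rw [hadj]
    rcases hsupp x with rfl | rfl <;> rcases hsupp y with rfl | rfl <;>
      simp [hne, h, h.symm, completeGraph]

theorem two_pow_mul_three_pow_inj {a b a' b' : ℕ} (h : 2 ^ a * 3 ^ b = 2 ^ a' * 3 ^ b') :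
    a = a' ∧ b = b' := by
  have h2 := congrArg (fun n => n.factorization 2) h
  have h3 := congrArg (fun n => n.factorization 3) h
  have e2 : (2 : ℕ).factorization 3 = 0 := Nat.factorization_eq_zero_of_not_dvd (by norm_num)
  have e3 : (3 : ℕ).factorization 2 = 0 := Nat.factorization_eq_zero_of_not_dvd (by norm_num)
  have e4 : (2 : ℕ).factorization 2 = 1 := Nat.prime_two.factorization_self
  have e5 : (3 : ℕ).factorization 3 = 1 := Nat.prime_three.factorization_self
  simp only [Nat.factorization_mul (pow_ne_zero _ two_ne_zero) (pow_ne_zero _ three_ne_zero),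
    Nat.factorization_pow, Finsupp.add_apply, Finsupp.smul_apply, e2, e3, e4, e5] at h2 h3
  simpa using And.intro h2 h3

/-- A labelling by `1, 2, 3` with prescribed edges labelled `2` and `3`. -/
theorem exists_isPProper_of_indicators {V : Type*} [Fintype V] (G : SimpleGraph V) [DecidableRel G.Adj]
    (f g : V → V → ℕ) (fs : ∀ x y, f x y = f y x) (gs : ∀ x y, g x y = g y x)
    (h1 : ∀ x y, f x y + g x y ≤ 1) (ha : ∀ x y, f x y + g x y ≠ 0 → G.Adj x y)
    (hne : ∀ x y, G.Adj x y → ∑ z, f x z ≠ ∑ z, f y z ∨ ∑ z, g x z ≠ ∑ z, g y z) :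
    ∃ l : G.EdgeLabelling123 3, G.IsPProper l := by
  classical
  let L : Sym2 V → ℕ := Sym2.lift ⟨fun x y => 1 + f x y + 2 * g x y, fun x y => by simp only [fs x y, gs x y]⟩
  have hLxy : ∀ x y, L s(x, y) = 1 + f x y + 2 * g x y := fun _ _ => rfl
  have hL : ∀ e, L e ∈ Finset.Icc 1 3 := by
    intro e
    induction e with
    | _ x y =>
      have := h1 x y
      rw [hLxy, Finset.mem_Icc]
      omega
  let l : G.EdgeLabelling123 3 := fun e => ⟨L e, hL e⟩
  have hprod : ∀ x, G.labelProduct l x = 2 ^ (∑ z, f x z) * 3 ^ (∑ z, g x z) := by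
    intro x
    have e1 : ∀ z, 1 + f x z + 2 * g x z = 2 ^ f x z * 3 ^ g x z := by
      intro z
      have := h1 x z
      have : (f x z = 0 ∧ g x z = 0) ∨ (f x z = 1 ∧ g x z = 0) ∨ (f x z = 0 ∧ g x z = 1) := by omega
      rcases this with ⟨h, h'⟩ | ⟨h, h'⟩ | ⟨h, h'⟩ <;> simp [h, h']
    have e2 : G.labelProduct l x = ∏ z : G.neighborSet x, (1 + f x z + 2 * g x z) := rfl
    rw [e2, ← Finset.prod_pow_eq_pow_sum, ← Finset.prod_pow_eq_pow_sum, ← Finset.prod_mul_distrib]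
    simp only [← e1]
    have e4 : ∏ z : G.neighborSet x, (1 + f x z + 2 * g x z) =
        ∏ z ∈ Finset.univ.filter (fun z => G.Adj x z), (1 + f x z + 2 * g x z) :=
      (Finset.prod_subtype _ (by simp) fun z => 1 + f x z + 2 * g x z).symm
    rw [e4, Finset.prod_filter]
    refine Finset.prod_congr rfl fun z _ => ?_
    split_ifs with h
    · rfl
    · have : f x z + g x z = 0 := by
        by_contra h'
        exact h (ha x z h')
      have e5 : f x z = 0 := by omega
      have e6 : g x z = 0 := by omega
      simp [e5, e6]
  refine ⟨l, fun x y hxy h => ?_⟩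
  rw [hprod, hprod] at h
  obtain ⟨h2, h3⟩ := two_pow_mul_three_pow_inj h
  rcases hne x y hxy with h' | h'
  · exact h' h2
  · exact h' h3


theorem IsNice.exists_indicators {V : Type*} [Fintype V] {G : SimpleGraph V} (hG : G.IsNice) :
    ∃ f g : V → V → ℕ, (∀ x y, f x y = f y x) ∧ (∀ x y, g x y = g y x) ∧
      (∀ x y, f x y + g x y ≤ 1) ∧ (∀ x y, f x y + g x y ≠ 0 → G.Adj x y) ∧
      ∀ x y, G.Adj x y → ∑ z, f x z ≠ ∑ z, f y z ∨ ∑ z, g x z ≠ ∑ z, g y z := by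
  classical
  obtain ⟨col, Y, Φ, hcol, hpos, hY, hY12, hΦ, hΦex⟩ := G.exists_layered_colouring
  set H := G.edgesWithin (col · ≤ 2) with hH
  obtain ⟨O, hO0, hO⟩ := G.exists_out_sets col Y (fun x => univ.filter (Φ x)) hY (by
    intro x k hk
    simp only [mem_filter, mem_univ, true_and] at hk
    obtain ⟨h1, h2, h3, h4, h5⟩ := hΦ x k hk
    refine ⟨h1, h3, h4, ?_, ?_⟩
    · rintro rfl
      exact h5 (.refl _)
    · rintro rfl
      exact h5 (hY12 x h2))
  set In : V → ℕ := fun x => (univ.filter fun y => x ∈ O y).card with hIn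
  have hmemO : ∀ x y, y ∈ O x → 3 ≤ col x ∧ G.Adj x y ∧ col y < col x := by
    intro x y hy
    have h3 : 3 ≤ col x := by
      by_contra h
      rw [hO0 x (by omega)] at hy
      simp at hy
    exact ⟨h3, (hO x h3).1 y hy⟩
  have hIn0 : ∀ x z, z ∈ O x → In z ≠ 0 := fun x z hz =>
    (Finset.card_pos.2 ⟨x, by simp [hz]⟩).ne'
  have hHle : ∀ x y, H.Adj x y → G.Adj x y ∧ col x ≤ 2 ∧ col y ≤ 2 := fun x y h => h
  obtain ⟨f, g, fs, gs, fg1, fga, d₂, d₃, hd₂, hd₃, hd, hdne⟩ := H.exists_bipartite_labelling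
    (fun v => decide (col v = 2)) (fun x y h => by
      have h1 := hHle x y h
      have h2 := hcol x y h1.1
      have h3 := hpos x
      have h4 := hpos y
      intro h5
      simp only [decide_eq_decide] at h5
      omega)
    -- A `K₂` component of `H` receiving nothing has no neighbour outside `H`: otherwise some `O y`
    -- would contain `Y y 1`, `Y y 2` or a selected vertex in it. It would thus be a `K₂` component
    -- of `G`.
    (fun v => if col v ≤ 2 then In v else 0) (by
      intro u v huv hu hv hnu hnv
      have h1 := hHle u v huv
      simp only [h1.2.1, h1.2.2, if_true] at hu hv
      have hreach : ∀ z, H.Reachable u z → z = u ∨ z = v := by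
        have key : ∀ (a b : V) (q : H.Walk a b), (a = u ∨ a = v) → (b = u ∨ b = v) := by
          intro a b q
          induction q with
          | nil => exact id
          | cons hab q ih =>
            rintro (rfl | rfl)
            · exact ih (Or.inr (hnu _ hab))
            · exact ih (Or.inl (hnv _ hab))
        rintro z ⟨p⟩
        exact key u z p (Or.inl rfl)
      have hzero : ∀ z, H.Reachable u z → In z = 0 := by
        intro z hz
        rcases hreach z hz with rfl | rfl
        · exact hu
        · exact hv
      have hno : ∀ z x, H.Reachable u z → G.Adj x z → ¬ 3 ≤ col x := by
        intro z x hz hxz hx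
        obtain ⟨y, hy, h | ⟨k, hk, hr⟩⟩ := hΦex u z x h1.2.1 hz hxz hx
        · rcases (hO y hy).2.2.1 with h' | h'
          · exact hIn0 y _ h' (hzero _ h)
          · exact hIn0 y _ h' (hzero _ (h.trans (hY12 y hy)))
        · exact hIn0 y k ((hO y hy).2.1 (by simp [hk])) (hzero k hr)
      refine hG.exists_adj_of_adj h1.1 (fun w hw => hnu w ⟨hw, h1.2.1, ?_⟩)
        (fun w hw => hnv w ⟨hw, h1.2.2, ?_⟩)
      · have := hno u w (.refl _) hw.symm
        change col w ≤ 2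
        omega
      · have := hno v w huv.reachable hw.symm
        change col w ≤ 2
        omega)
  -- `a 0` marks the downward edges labelled 2 (even lower colour), `a 1` those labelled 3 (odd
  -- lower colour).
  set a : ℕ → V → V → ℕ := fun r x y => if y ∈ O x ∧ col y % 2 = r then 1 else 0 with ha
  have sum_a : ∀ r x, ∑ y, a r x y = ((O x).filter fun y => col y % 2 = r).card := by
    intro r x
    simp only [ha, ← Finset.card_filter]
    congr 1
    ext y
    simp
  have sum_a' : ∀ r x, ∑ y, a r y x = if col x % 2 = r then In x else 0 := by
    intro r x
    by_cases h : col x % 2 = r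
    · simp [ha, h, hIn]
    · simp [ha, h]
  have aO : ∀ r x y, a r x y ≠ 0 → y ∈ O x ∧ col y % 2 = r := by
    intro r x y h
    by_contra h'
    simp [ha, h'] at h
  have a_le : ∀ r x y, a r x y ≤ 1 := fun r x y => by
    simp only [ha]
    split_ifs <;> simp
  set D₂ : V → ℕ := fun x => ∑ y, (f x y + a 0 x y + a 0 y x) with hD₂
  set D₃ : V → ℕ := fun x => ∑ y, (g x y + a 1 x y + a 1 y x) with hD₃
  have low : ∀ x, col x ≤ 2 → D₂ x = d₂ x ∧ D₃ x = d₃ x := by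
    intro x hx
    have h1 := hpos x
    have h2 : O x = ∅ := hO0 x (by omega)
    simp only [hD₂, hD₃, Finset.sum_add_distrib, sum_a, sum_a', hd₂, hd₃, h2, hx]
    have : col x = 1 ∨ col x = 2 := by omega
    rcases this with h | h <;> simp [h] <;> ring
  have high : ∀ x, 3 ≤ col x →
      D₂ x = ((O x).filter fun y => col y % 2 = 0).card + (if col x % 2 = 0 then In x else 0) ∧
      D₃ x = ((O x).filter fun y => col y % 2 = 1).card + (if col x % 2 = 1 then In x else 0) := by
    intro x hx
    have hz : ∀ y, f x y + g x y = 0 := by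
      intro y
      by_contra h
      have := (hHle x y (fga x y h)).2.1
      omega
    have h1 : ∑ y, f x y = 0 := Finset.sum_eq_zero fun y _ => by
      have := hz y
      omega
    have h2 : ∑ y, g x y = 0 := Finset.sum_eq_zero fun y _ => by
      have := hz y
      omega
    simp only [hD₂, hD₃, Finset.sum_add_distrib, sum_a, sum_a', h1, h2, zero_add, and_self]
  have high_even : ∀ x, 3 ≤ col x → col x % 2 = 0 →
      D₃ x = col x / 2 ∧ D₂ x ≠ 0 ∧ (D₂ x + col x / 2) % 2 = 1 := by
    intro x hx he
    obtain ⟨h2, h3⟩ := high x hx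
    obtain ⟨-, -, -, h4, h5, h6⟩ := hO x hx
    simp only [he] at h2 h3 h4 h5 h6
    have e : ((O x).filter fun y => col y % 2 ≠ 0) = (O x).filter fun y => col y % 2 = 1 :=
      Finset.filter_congr fun y _ => by omega
    rw [e] at h4
    rw [if_pos trivial] at h2
    rw [if_neg (by norm_num), h4] at h3
    rw [Nat.even_iff] at h6
    refine ⟨h3, by rw [h2]; simp only [hIn]; omega, ?_⟩
    rw [h2]
    simp only [hIn]
    omega
  have high_odd : ∀ x, 3 ≤ col x → col x % 2 = 1 →
      D₂ x = col x / 2 ∧ D₃ x ≠ 0 ∧ (D₃ x + col x / 2) % 2 = 0 := by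
    intro x hx ho
    obtain ⟨h2, h3⟩ := high x hx
    obtain ⟨-, -, -, h4, h5, h6⟩ := hO x hx
    simp only [ho] at h2 h3 h4 h5 h6
    have e : ((O x).filter fun y => col y % 2 ≠ 1) = (O x).filter fun y => col y % 2 = 0 :=
      Finset.filter_congr fun y _ => by omega
    rw [e] at h4
    rw [if_pos trivial] at h3
    rw [if_neg (by norm_num), h4] at h2
    rw [Nat.even_iff] at h6
    refine ⟨h2, by rw [h3]; simp only [hIn]; omega, ?_⟩
    rw [h3]
    simp only [hIn]
    omega
  have low_high : ∀ x y, col x ≤ 2 → 3 ≤ col y → D₂ x ≠ D₂ y ∨ D₃ x ≠ D₃ y := by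
    intro x y hx hy
    by_contra! h
    have h1 := hd x
    rw [← (low x hx).1, ← (low x hx).2, h.1, h.2, Nat.even_iff] at h1
    rcases Nat.mod_two_eq_zero_or_one (col y) with he | ho
    · have := high_even y hy he
      omega
    · have := high_odd y hy ho
      omega
  refine ⟨fun x y => f x y + a 0 x y + a 0 y x, fun x y => g x y + a 1 x y + a 1 y x, fun x y => ?_,
    fun x y => ?_, fun x y => ?_, fun x y h => ?_, fun x y hxy => ?_⟩
  · simp only [fs x y]
    ring
  · simp only [gs x y]
    ring
  · beta_reduce
    have h1 := fg1 x y
    have hxy : ∀ r x y, a r x y ≠ 0 → f x y + g x y = 0 ∧ a 0 y x = 0 ∧ a 1 y x = 0 := by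
      intro r x y h
      obtain ⟨h2, h3, h4⟩ := hmemO x y (aO r x y h).1
      refine ⟨?_, ?_, ?_⟩
      · by_contra h'
        have := (hHle x y (fga x y h')).2.1
        omega
      · by_contra h'
        have := (hmemO y x (aO _ y x h').1).2.2
        omega
      · by_contra h'
        have := (hmemO y x (aO _ y x h').1).2.2
        omega
    have h01 : ∀ x y, a 0 x y = 0 ∨ a 1 x y = 0 := by
      intro x y
      by_contra! h
      have h2 := (aO 0 x y h.1).2
      have h3 := (aO 1 x y h.2).2
      omega
    have l1 := a_le 0 x y
    have l2 := a_le 1 x y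
    have l3 := a_le 0 y x
    have l4 := a_le 1 y x
    have m1 := h01 x y
    have m2 := h01 y x
    have n1 := hxy 0 x y
    have n2 := hxy 1 x y
    have n3 := hxy 0 y x
    have n4 := hxy 1 y x
    rw [fs y x, gs y x] at n3 n4
    omega
  · beta_reduce at h
    by_cases h1 : f x y + g x y = 0
    · by_cases h2 : a 0 x y = 0
      · by_cases h3 : a 1 x y = 0
        · by_cases h4 : a 0 y x = 0
          · exact (hmemO y x (aO 1 y x (by omega)).1).2.1.symm
          · exact (hmemO y x (aO _ y x h4).1).2.1.symm
        · exact (hmemO x y (aO _ x y h3).1).2.1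
      · exact (hmemO x y (aO _ x y h2).1).2.1
    · exact (hHle x y (fga x y h1)).1
  · change D₂ x ≠ D₂ y ∨ D₃ x ≠ D₃ y
    by_cases hx : col x ≤ 2
    · by_cases hy : col y ≤ 2
      · rw [(low x hx).1, (low x hx).2, (low y hy).1, (low y hy).2]
        exact hdne x y ⟨hxy, hx, hy⟩
      · exact low_high x y hx (by omega)
    · by_cases hy : col y ≤ 2
      · exact (low_high y x hy (by omega)).imp Ne.symm Ne.symm
      · have hne := hcol x y hxy
        rcases Nat.mod_two_eq_zero_or_one (col x) with he | ho <;>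
          rcases Nat.mod_two_eq_zero_or_one (col y) with he' | ho'
        · have h1 := high_even x (by omega) he
          have h2 := high_even y (by omega) he'
          omega
        · have h1 := high_even x (by omega) he
          have h2 := high_odd y (by omega) ho'
          omega
        · have h1 := high_odd x (by omega) ho
          have h2 := high_even y (by omega) he'
          omega
        · have h1 := high_odd x (by omega) ho
          have h2 := high_odd y (by omega) ho'
          omega

end SimpleGraph

theorem theorem1p1 {V : Type*} [Fintype V] (G : SimpleGraph V) [DecidableRel G.Adj]
    (hG : G.IsNice) :
    (∃ l : G.EdgeLabelling123 3, G.IsPProper l) ∧ G.chiP ≤ 3 := by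
  obtain ⟨f, g, fs, gs, h1, ha, hne⟩ := hG.exists_indicators
  obtain ⟨l, hl⟩ := G.exists_isPProper_of_indicators f g fs gs h1 ha hne
  exact ⟨⟨l, hl⟩, sInf_le ⟨3, rfl, by norm_num, l, hl⟩⟩
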